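/- Setting (convenient calculus of Frölicher, Kriegl and Michor). A convenient vector space is a Hausdorff locally convex real vector space in which every Mackey–Cauchy sequence converges; smooth maps are the maps that send smooth curves to smooth curves; manifolds are Hausdorff and modelled, by charts with smooth changes of charts, on $c^\infty$-open subsets of convenient spaces. For a manifold $M$ let $TM$ be the kinematic tangent bundle and $T'M$ the kinematic cotangent bundle, whose fibres are the bornological duals $(T_xM)'$ of bounded linear forms. A weak subbundle $T^\flat M\subset T'M$ is a convenient vector bundle whose fibres are linear subspaces $T^\flat_xM\subset T'_xM$ and whose inclusion into $T'M$ is a morphism of convenient bundles. For $U\subset M$ open, $\mathfrak A(U)$ is the set of $f\in C^\infty(U)$ whose differential $df$ is a smooth section of $T^\flat M$ over $U$. An almost Poisson anchor is a morphism of convenient bundles $P:T^\flat M\to TM$ with $\langle\xi,P\eta\rangle=-\langle\eta,P\xi\rangle$; put $\{f,g\}_P=-\langle df,P(dg)\rangle$ for $f,g\in\mathfrak A(U)$. The anchor $P$ defines a partial Poisson structure on $M$ if, for every open $U\subset M$, the bracket $\{\cdot,\cdot\}_P$ maps $\mathfrak A(U)\times\mathfrak A(U)$ to $\mathfrak A(U)$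 and satisfies the Jacobi identity there. A distribution $\mathcal D$ on $M$ is a choice of linear subspaces $\mathcal D_x\subset T_xM$. It is integrable if through each point there passes an integral manifold, that is, a manifold $L$ with a smooth injective map $f:L\to M$ whose tangent maps are injective and satisfy $T_zf(T_zL)=\mathcal D_{f(z)}$ for all $z\in L$; its leaves are its maximal connected integral manifolds. Theorem. Let $P:T^\flat M\to TM$ define a partial Poisson structure on a manifold $M$, and let $\mathcal D$ be an integrable distribution on $M$. Let $\check M$ be a manifold and let $\jmath:M\to\check M$ be a surjective submersion (around each point it is, in suitable charts, a bounded linear map with a bounded linear right inverse) whose fibres are exactly the connected leaves of $\mathcal D$, so that $\check M=M/\mathcal D$. For $x\in M$ and $\check\xi\in T'_{\jmath(x)}\check M$ write $\delta\jmath(x)\check\xi=\check\xi\circ d\jmath(x)\in T'_xM$. Let $T^\flat\check M\subset T'\check M$ be a weak subbundle induced by $T^\flat M$ in the following sense: (a) $\delta\jmath$ maps $\jmath^*T^\flat\check M$ smoothly into $T^\flat M$ (smooth curves to smooth curves); (b) for $V\subset\check M$ open, every $1$-form $\check\alpha$ on $V$ whose pullback $x\mapsto\delta\jmath(x)\check\alpha(\jmath(x))$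 is a smooth section of $T^\flat M$ over $\jmath^{-1}(V)$ is a smooth section of $T^\flat\check M$. Assume (PpP) for every open $V\subset\check M$, if $\alpha$ is a smooth section of $T^\flat M$ over $\jmath^{-1}(V)$ which is projectable, i.e. $\alpha(x)=\delta\jmath(x)\check\alpha(\jmath(x))$ for some smooth $1$-form $\check\alpha$ on $V$, then the vector field $P\alpha$ on $\jmath^{-1}(V)$ is projectable, i.e. $d\jmath(x_1)P\alpha(x_1)=d\jmath(x_2)P\alpha(x_2)$ whenever $x_1,x_2\in\jmath^{-1}(V)$ lie in the same leaf. Then there is exactly one almost Poisson anchor $\check P:T^\flat\check M\to T\check M$ that defines a partial Poisson structure on $\check M$ and satisfies $\check P=d\jmath\circ P\circ\delta\jmath$, that is, $$\check P_{\jmath(x)}(\check\xi)=d\jmath(x)\,P_x\bigl(\delta\jmath(x)\check\xi\bigr)\qquad\text{for all }x\in M,\ \check\xi\in T^\flat_{\jmath(x)}\check M .$$ -/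

import Mathlib

open Set Filter Topology
open scoped Pointwise

noncomputable section

namespace PartialPoisson

/-! ## Convenient vector spaces and smooth curves -/

/-- A convenient (that is, `c^∞`-complete) vector space: a Hausdorff locally convex real vector
space in which every Mackey-Cauchy sequence converges. -/
class ConvenientSpace (E : Type*) [AddCommGroup E] [Module ℝ E] [TopologicalSpace E] : Prop
    extends IsTopologicalAddGroup E, ContinuousSMul ℝ E, LocallyConvexSpace ℝ E, T2Space E where
  mackey_complete : ∀ x : ℕ → E,
    (∃ B : Set E, Bornology.IsVonNBounded ℝ B ∧ AbsConvex ℝ B ∧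
      ∀ ε : ℝ, 0 < ε → ∃ N : ℕ, ∀ m n : ℕ, N < m → m < n → x m - x n ∈ ε • B) →
    ∃ y : E, Tendsto x atTop (𝓝 y)

section Curves

variable {E F : Type*} [AddCommGroup E] [Module ℝ E] [TopologicalSpace E]
  [AddCommGroup F] [Module ℝ F] [TopologicalSpace F]

/-- The curve `c` is infinitely differentiable on the open set `J` of parameters; its values
outside `J` are irrelevant. Everywhere below, curves are parametrised by open subsets of `ℝ`;
as every germ of a smooth curve is the germ of a smooth curve defined on `ℝ`, testing with curves
on `ℝ` only would give the same notions. -/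
def CurveSmoothOn (J : Set ℝ) (c : ℝ → E) : Prop :=
  ∀ n : ℕ, ∀ t ∈ J, DifferentiableAt ℝ (deriv^[n] c) t

/-- The directional derivative of `f` at `u` in the direction `v`. -/
def dirDeriv (f : E → F) (u v : E) : F :=
  deriv (fun t : ℝ => f (u + t • v)) 0

/-- A map is smooth on `U` if it maps smooth curves in `U` to smooth curves. -/
def SmoothMapOn (U : Set E) (f : E → F) : Prop :=
  ∀ (J : Set ℝ) (c : ℝ → E), IsOpen J → CurveSmoothOn J c → MapsTo c J U →
    CurveSmoothOn J (f ∘ c)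

/-- A linear map is bounded if it maps bounded sets to bounded sets. -/
def BoundedLinear (L : E →ₗ[ℝ] F) : Prop :=
  ∀ B : Set E, Bornology.IsVonNBounded ℝ B → Bornology.IsVonNBounded ℝ (L '' B)

end Curves

/-- The vector space `E`, to be equipped with its `c^∞`-topology. -/
def CInf (E : Type*) : Type _ := E

/-- The identity `E → c^∞E`. -/
def CInf.of {E : Type*} (v : E) : CInf E := v

/-- The identity `c^∞E → E`. -/
def CInf.out {E : Type*} (v : CInf E) : E := v

/-- The `c^∞`-topology: the final topology for all smooth curves. -/
instance CInf.topology (E : Type*) [AddCommGroup E] [Module ℝ E] [TopologicalSpace E] :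
    TopologicalSpace (CInf E) where
  IsOpen U := ∀ (J : Set ℝ) (c : ℝ → E), IsOpen J → CurveSmoothOn J c →
    IsOpen (J ∩ (fun t => CInf.of (c t)) ⁻¹' U)
  isOpen_univ := fun J c hJ _ => by simpa using hJ
  isOpen_inter := fun U V hU hV J c hJ hc => by
    have h := (hU J c hJ hc).inter (hV J c hJ hc)
    rwa [← inter_inter_distrib_left, ← preimage_inter] at h
  isOpen_sUnion := fun S hS J c hJ hc => by
    rw [preimage_sUnion, inter_iUnion₂]
    exact isOpen_biUnion fun U hU => hS U hU J c hJ hc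

/-! ## The bornological dual -/

section Dual

variable (E : Type*) [AddCommGroup E] [Module ℝ E] [TopologicalSpace E]

/-- The bounded linear forms on `E`. -/
def bornologicalDual : Submodule ℝ (E →ₗ[ℝ] ℝ) where
  carrier := {ξ | BoundedLinear ξ}
  zero_mem' := fun B _ => by
    refine Bornology.IsVonNBounded.subset ?_ (Bornology.isVonNBounded_singleton (𝕜 := ℝ) (0 : ℝ))
    rintro _ ⟨v, -, rfl⟩
    simp
  add_mem' := fun {ξ η} hξ hη B hB => by
    refine Bornology.IsVonNBounded.subset ?_ ((hξ B hB).add (hη B hB))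
    rintro _ ⟨v, hv, rfl⟩
    exact add_mem_add ⟨v, hv, rfl⟩ ⟨v, hv, rfl⟩
  smul_mem' := fun r ξ hξ B hB => by
    have h := (hξ B hB).image (r • ContinuousLinearMap.id ℝ ℝ)
    refine Bornology.IsVonNBounded.subset ?_ h
    rintro _ ⟨v, hv, rfl⟩
    exact ⟨ξ v, ⟨v, hv, rfl⟩, by simp⟩

/-- The bornological dual `E'`. -/
def BornDual : Type _ := ↥(bornologicalDual E)

instance : AddCommGroup (BornDual E) := inferInstanceAs (AddCommGroup ↥(bornologicalDual E))

instance : Module ℝ (BornDual E) := inferInstanceAs (Module ℝ ↥(bornologicalDual E))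

instance : CoeFun (BornDual E) (fun _ => E → ℝ) := ⟨fun ξ => ξ.1⟩

/-- The topology of uniform convergence on bounded sets. -/
instance : TopologicalSpace (BornDual E) :=
  TopologicalSpace.induced
    (fun ξ => UniformOnFun.ofFun {B : Set E | Bornology.IsVonNBounded ℝ B} (fun v => ξ v))
    inferInstance

end Dual

/-! ## Convenient manifolds, tangent and cotangent bundle -/

section Manifold

variable {E : Type*} [AddCommGroup E] [Module ℝ E] [TopologicalSpace E]
  {M : Type*} [TopologicalSpace M]

/-- The change of charts `ψ ∘ φ⁻¹`, as a map of `E` (relevant on `φ (φ.source ∩ ψ.source)`). -/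
def transition (φ ψ : OpenPartialHomeomorph M (CInf E)) (u : E) : E :=
  (ψ (φ.symm (CInf.of u))).out

/-- Both changes of charts between `φ` and `ψ` are smooth. -/
def ChartsCompatible (φ ψ : OpenPartialHomeomorph M (CInf E)) : Prop :=
  SmoothMapOn {u : E | CInf.of u ∈ φ.target ∧ φ.symm (CInf.of u) ∈ ψ.source} (transition φ ψ) ∧
  SmoothMapOn {u : E | CInf.of u ∈ ψ.target ∧ ψ.symm (CInf.of u) ∈ φ.source} (transition ψ φ)

variable (E M) in
/-- A (Hausdorff) convenient manifold modelled on `E`: its charts are homeomorphisms onto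
`c^∞`-open subsets of `E`, and the changes of charts are smooth. -/
class ConvenientManifold [ChartedSpace (CInf E) M] : Prop extends T2Space M where
  compatible : ∀ φ ∈ atlas (CInf E) M, ∀ ψ ∈ atlas (CInf E) M, ChartsCompatible φ ψ

variable [ChartedSpace (CInf E) M]

/-- `φ` is a chart of the manifold `M`, that is, an element of the maximal atlas. -/
def IsChart (φ : OpenPartialHomeomorph M (CInf E)) : Prop :=
  ∀ ψ ∈ atlas (CInf E) M, ChartsCompatible φ ψ

variable (E) in
/-- `c` is a smooth curve in `M` for parameters in the open set `J`. -/
def MCurveSmoothOn (J : Set ℝ) (c : ℝ → M) : Prop :=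
  ContinuousOn c J ∧ ∀ φ ∈ atlas (CInf E) M,
    CurveSmoothOn (J ∩ c ⁻¹' φ.source) (fun t => (φ (c t)).out)

variable (E) in
/-- Smooth real functions on the open set `U` of `M`. -/
def SmoothFunOn (U : Set M) (f : M → ℝ) : Prop :=
  ∀ (J : Set ℝ) (c : ℝ → M), IsOpen J → MCurveSmoothOn E J c → MapsTo c J U →
    CurveSmoothOn J (f ∘ c)

variable (E) in
/-- The kinematic tangent space of `M` at `x`. A tangent vector is given by its coordinates in the
preferred chart `chartAt x`. -/
abbrev TSpace (_ : M) : Type _ := E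

variable (E) in
/-- The kinematic cotangent space of `M` at `x`, that is, the bornological dual of the tangent
space. -/
abbrev CotSpace (x : M) : Type _ := BornDual (TSpace E x)

/-- The coordinates in the chart `φ` of the tangent vector `v` at `x`. -/
def tangentCoord (φ : OpenPartialHomeomorph M (CInf E)) (x : M) (v : TSpace E x) : E :=
  dirDeriv (transition (chartAt (CInf E) x) φ) (chartAt (CInf E) x x).out v

/-- `t ↦ w t`, with `w t` a tangent vector at `c t`, is a smooth curve in the tangent bundle. -/
def TangentCurveSmoothOn (J : Set ℝ) (c : ℝ → M) (w : ∀ t, TSpace E (c t)) : Prop :=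
  MCurveSmoothOn E J c ∧ ∀ φ ∈ atlas (CInf E) M,
    CurveSmoothOn (J ∩ c ⁻¹' φ.source) (fun t => tangentCoord φ (c t) (w t))

/-- `t ↦ ξ t`, with `ξ t` a cotangent vector at `c t`, is a smooth curve in the cotangent bundle:
in every chart, its coordinates `η` form a smooth curve in the bornological dual of `E`. -/
def CotangentCurveSmoothOn (J : Set ℝ) (c : ℝ → M) (ξ : ∀ t, CotSpace E (c t)) : Prop :=
  MCurveSmoothOn E J c ∧ ∀ φ ∈ atlas (CInf E) M, ∃ η : ℝ → BornDual E,
    CurveSmoothOn (J ∩ c ⁻¹' φ.source) η ∧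
    ∀ t ∈ J ∩ c ⁻¹' φ.source, ∀ v : TSpace E (c t), ξ t v = η t (tangentCoord φ (c t) v)

/-- Smooth differential `1`-forms on the open set `U`. -/
def SmoothFormOn (U : Set M) (α : ∀ x : M, CotSpace E x) : Prop :=
  ∀ (J : Set ℝ) (c : ℝ → M), IsOpen J → MCurveSmoothOn E J c → MapsTo c J U →
    CotangentCurveSmoothOn J c (fun t => α (c t))

/-- The derivative `d_x f · v` of a real function. -/
def dFun (f : M → ℝ) (x : M) (v : TSpace E x) : ℝ :=
  dirDeriv (fun u : E => f ((chartAt (CInf E) x).symm (CInf.of u)))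
    (chartAt (CInf E) x x).out v

/-! ## Weak subbundles of the cotangent bundle, partial Poisson structures -/

variable (E M) in
/-- A weak subbundle `T^♭M` of the cotangent bundle with typical fibre the convenient space `F`:
a convenient vector bundle whose fibres are linear subspaces of those of the cotangent bundle and
whose inclusion is a morphism of convenient bundles. Local trivialisations are indexed by the
points of `M`. -/
structure WeakSubbundle (F : Type*) [AddCommGroup F] [Module ℝ F] [TopologicalSpace F] where
  /-- The fibre `T^♭_x M`. -/
  fiber : ∀ x : M, Submodule ℝ (CotSpace E x)
  /-- The domain of the trivialisation around `x₀`. -/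
  base : M → Set M
  isOpen_base : ∀ x₀ : M, IsOpen (base x₀)
  mem_base : ∀ x₀, x₀ ∈ base x₀
  /-- The trivialisation around `x₀`, as a map from the typical fibre to the fibre at `x`. -/
  triv : M → ∀ x : M, F →ₗ[ℝ] CotSpace E x
  triv_injective : ∀ x₀, ∀ x ∈ base x₀, Function.Injective (triv x₀ x)
  range_triv : ∀ x₀, ∀ x ∈ base x₀, LinearMap.range (triv x₀ x) = fiber x
  /-- The changes of trivialisations are smooth. -/
  smooth_transition : ∀ (x₀ x₁ : M) (J : Set ℝ) (c : ℝ → M) (v w : ℝ → F), IsOpen J →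
    MCurveSmoothOn E J c → MapsTo c J (base x₀ ∩ base x₁) → CurveSmoothOn J v →
    (∀ t ∈ J, triv x₀ (c t) (v t) = triv x₁ (c t) (w t)) → CurveSmoothOn J w
  /-- The inclusion into the cotangent bundle is smooth. -/
  smooth_incl : ∀ (x₀ : M) (J : Set ℝ) (c : ℝ → M) (v : ℝ → F), IsOpen J →
    MCurveSmoothOn E J c → MapsTo c J (base x₀) → CurveSmoothOn J v →
    CotangentCurveSmoothOn J c (fun t => triv x₀ (c t) (v t))

variable {F : Type*} [AddCommGroup F] [Module ℝ F] [TopologicalSpace F]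

namespace WeakSubbundle

/-- `t ↦ ξ t`, with `ξ t` a cotangent vector at `c t`, is a smooth curve in `T^♭M`. -/
def CurveSmoothOn (T : WeakSubbundle E M F) (J : Set ℝ) (c : ℝ → M)
    (ξ : ∀ t, CotSpace E (c t)) : Prop :=
  MCurveSmoothOn E J c ∧ ∀ x₀ : M, ∃ v : ℝ → F,
    PartialPoisson.CurveSmoothOn (J ∩ c ⁻¹' T.base x₀) v ∧
    ∀ t ∈ J ∩ c ⁻¹' T.base x₀, ξ t = T.triv x₀ (c t) (v t)

/-- `α` is a smooth section of `T^♭M` over the open set `U`. -/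
def SectionOn (T : WeakSubbundle E M F) (U : Set M) (α : ∀ x : M, CotSpace E x) : Prop :=
  ∀ (J : Set ℝ) (c : ℝ → M), IsOpen J → MCurveSmoothOn E J c → MapsTo c J U →
    T.CurveSmoothOn J c (fun t => α (c t))

/-- The set `𝔄(U)` of smooth functions on `U` whose differential is a smooth section of `T^♭M`. -/
def Admissible (T : WeakSubbundle E M F) (U : Set M) (f : M → ℝ) : Prop :=
  SmoothFunOn E U f ∧ ∃ α : ∀ x : M, CotSpace E x, T.SectionOn U α ∧
    ∀ x ∈ U, ∀ v : TSpace E x, α x v = dFun f x v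

end WeakSubbundle

/-- An almost Poisson anchor: an antisymmetric morphism of convenient bundles
`P : T^♭M → TM`. -/
structure AlmostAnchor (T : WeakSubbundle E M F) where
  /-- The linear map `P_x : T^♭_x M → T_x M`. -/
  toFun : ∀ x : M, T.fiber x →ₗ[ℝ] TSpace E x
  smooth : ∀ (J : Set ℝ) (c : ℝ → M) (ξ : ∀ t, T.fiber (c t)), IsOpen J →
    T.CurveSmoothOn J c (fun t => (ξ t).1) → TangentCurveSmoothOn J c (fun t => toFun (c t) (ξ t))
  antisymm : ∀ (x : M) (ξ η : T.fiber x), ξ.1 (toFun x η) = -η.1 (toFun x ξ)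

namespace AlmostAnchor

variable {T : WeakSubbundle E M F}

open Classical in
/-- The bracket `{f, g}_P = -⟨df, P(dg)⟩`; it has the value `0` at the points where the
differential of `g` is not in `T^♭M`. -/
def bracket (P : AlmostAnchor T) (f g : M → ℝ) (x : M) : ℝ :=
  if h : ∃ η : T.fiber x, ∀ v : TSpace E x, η.1 v = dFun g x v then
    -dFun f x (P.toFun x h.choose) else 0

/-- `P` defines a partial Poisson structure: for every open `U`, the bracket takes values in
`𝔄(U)` on `𝔄(U) × 𝔄(U)` and satisfies the Jacobi identity. -/
structure IsPartialPoisson (P : AlmostAnchor T) : Prop where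
  bracket_mem : ∀ (U : Set M) (f g : M → ℝ), IsOpen U → T.Admissible U f → T.Admissible U g →
    T.Admissible U (P.bracket f g)
  jacobi : ∀ (U : Set M) (f g h : M → ℝ), IsOpen U → T.Admissible U f → T.Admissible U g →
    T.Admissible U h → ∀ x ∈ U,
      P.bracket f (P.bracket g h) x + P.bracket g (P.bracket h f) x
        + P.bracket h (P.bracket f g) x = 0

end AlmostAnchor

end Manifold

/-! ## Maps between manifolds, submersions, distributions -/

section Maps

variable {E : Type*} [AddCommGroup E] [Module ℝ E] [TopologicalSpace E]
  {M : Type*} [TopologicalSpace M] [ChartedSpace (CInf E) M]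
  {E' : Type*} [AddCommGroup E'] [Module ℝ E'] [TopologicalSpace E']
  {M' : Type*} [TopologicalSpace M'] [ChartedSpace (CInf E') M']

variable (E E') in
/-- Smooth maps between manifolds. -/
def SmoothMap (j : M → M') : Prop :=
  ∀ (J : Set ℝ) (c : ℝ → M), IsOpen J → MCurveSmoothOn E J c → MCurveSmoothOn E' J (j ∘ c)

/-- The tangent map `d_x j : T_x M → T_{j x} M'`. -/
def dMap (j : M → M') (x : M) (v : TSpace E x) : TSpace E' (j x) :=
  dirDeriv
    (fun u : E => (chartAt (CInf E') (j x) (j ((chartAt (CInf E) x).symm (CInf.of u)))).out)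
    (chartAt (CInf E) x x).out v

/-- `ξ = δj(x) ξ'`: the covector `ξ` at `x` is the pullback of the covector `ξ'` at `j x`. -/
def IsPullback (j : M → M') (x : M) (ξ' : CotSpace E' (j x)) (ξ : CotSpace E x) : Prop :=
  ∀ v : TSpace E x, ξ v = ξ' (dMap j x v)

variable (E E') in
/-- Submersions: smooth maps which, in suitable charts around each point, are given by a bounded
linear projection, that is, by a bounded linear map with a bounded linear right inverse. -/
def IsSubmersion (j : M → M') : Prop :=
  SmoothMap E E' j ∧ ∀ x : M, ∃ (φ : OpenPartialHomeomorph M (CInf E))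
    (ψ : OpenPartialHomeomorph M' (CInf E')) (π : E →ₗ[ℝ] E') (s : E' →ₗ[ℝ] E),
    IsChart φ ∧ IsChart ψ ∧ x ∈ φ.source ∧ MapsTo j φ.source ψ.source ∧
    BoundedLinear π ∧ BoundedLinear s ∧ (∀ u : E', π (s u) = u) ∧
    ∀ z ∈ φ.source, (ψ (j z)).out = π (φ z).out

end Maps

section Distributions

universe u v

variable {E : Type u} [AddCommGroup E] [Module ℝ E] [TopologicalSpace E]
  {M : Type v} [TopologicalSpace M] [ChartedSpace (CInf E) M]

/-- An integral manifold of the distribution `D`: a weak immersed submanifold `f : L → M` (`f` is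
smooth and injective with injective tangent maps) with `d_z f (T_z L) = D_{f z}` for all `z`. -/
structure IntegralManifold (D : ∀ x : M, Submodule ℝ (TSpace E x)) where
  /-- The model space. -/
  G : Type u
  [addCommGroup : AddCommGroup G]
  [module : Module ℝ G]
  [topG : TopologicalSpace G]
  [convenient : ConvenientSpace G]
  /-- The manifold. -/
  L : Type v
  [topL : TopologicalSpace L]
  [charted : ChartedSpace (CInf G) L]
  [manifold : ConvenientManifold G L]
  /-- The immersion. -/
  f : L → M
  smooth : SmoothMap G E f
  injective : Function.Injective f
  injective_tangent : ∀ z : L, Function.Injective (dMap (E := G) (E' := E) f z)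
  range_tangent : ∀ z : L, Set.range (dMap (E := G) (E' := E) f z) = (D (f z) : Set (TSpace E (f z)))

/-- `D` is integrable if there is an integral manifold through each point. -/
def IsIntegrable (D : ∀ x : M, Submodule ℝ (TSpace E x)) : Prop :=
  ∀ x : M, ∃ I : IntegralManifold D, x ∈ Set.range I.f

/-- `S` is a leaf of `D`: a maximal connected integral manifold. -/
def IsLeaf (D : ∀ x : M, Submodule ℝ (TSpace E x)) (S : Set M) : Prop :=
  (∃ I : IntegralManifold D, @ConnectedSpace I.L I.topL ∧ Set.range I.f = S) ∧
  ∀ I : IntegralManifold D, @ConnectedSpace I.L I.topL → (Set.range I.f ∩ S).Nonempty →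
    Set.range I.f ⊆ S

variable {E' : Type*} [AddCommGroup E'] [Module ℝ E'] [TopologicalSpace E']
  {M' : Type*} [TopologicalSpace M'] [ChartedSpace (CInf E') M']

variable (E E') in
/-- `j : M → M'` exhibits the manifold `M'` as the quotient `M/D` of `M` by the leaves of `D`:
it is a surjective submersion whose fibres are the (connected) leaves of `D`. -/
structure IsLeafQuotient (D : ∀ x : M, Submodule ℝ (TSpace E x)) (j : M → M') : Prop where
  surjective : Function.Surjective j
  submersion : IsSubmersion E E' j
  fiber_leaf : ∀ y : M', IsLeaf D (j ⁻¹' {y})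

/-- The vector field `X` on the open set `U` of `M` is projectable: `dj · X` takes the same value
at any two points of `U` in the same leaf. -/
def ProjectableField (D : ∀ x : M, Submodule ℝ (TSpace E x)) (j : M → M') (U : Set M)
    (X : ∀ x : M, TSpace E x) : Prop :=
  ∀ S : Set M, IsLeaf D S → ∀ x₁ ∈ S ∩ U, ∀ x₂ ∈ S ∩ U,
    (dMap j x₁ (X x₁) : E') = (dMap j x₂ (X x₂) : E')

/-- The form `α` on `j⁻¹(V)` is projectable: it is the pullback of a smooth form on `V`. -/
def ProjectableForm (j : M → M') (V : Set M') (α : ∀ x : M, CotSpace E x) : Prop :=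
  ∃ α' : ∀ y : M', CotSpace E' y, SmoothFormOn V α' ∧
    ∀ x ∈ j ⁻¹' V, IsPullback j x (α' (j x)) (α x)

variable {F : Type*} [AddCommGroup F] [Module ℝ F] [TopologicalSpace F]
  {F' : Type*} [AddCommGroup F'] [Module ℝ F'] [TopologicalSpace F']

/-- Condition (PpP): `P` maps projectable forms (sections of `T^♭M`) to projectable vector fields,
over the inverse image of every open set of the quotient. -/
def MapsProjectable {T : WeakSubbundle E M F} (P : AlmostAnchor T)
    (D : ∀ x : M, Submodule ℝ (TSpace E x)) (j : M → M') : Prop :=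
  ∀ V : Set M', IsOpen V → ∀ α : ∀ x : M, T.fiber x, T.SectionOn (j ⁻¹' V) (fun x => (α x).1) →
    ProjectableForm (E' := E') j V (fun x => (α x).1) →
    ProjectableField (E' := E') D j (j ⁻¹' V) (fun x => P.toFun x (α x))

/-- The weak subbundle `T' = T^♭M'` of the cotangent bundle of `M'` is the one induced by
`T = T^♭M`: the pullback of covectors is a smooth bundle map `j^*T^♭M' → T^♭M`, and every form
on an open set whose pullback is a smooth section of `T^♭M` is a smooth section of `T^♭M'`. -/
structure IsInduced (T : WeakSubbundle E M F) (T' : WeakSubbundle E' M' F') (j : M → M') :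
    Prop where
  pullback_smooth : ∀ (J : Set ℝ) (c : ℝ → M) (ξ' : ∀ t, CotSpace E' (j (c t))), IsOpen J →
    MCurveSmoothOn E J c → T'.CurveSmoothOn J (fun t => j (c t)) ξ' →
    ∃ ξ : ∀ t, CotSpace E (c t), T.CurveSmoothOn J c ξ ∧ ∀ t ∈ J, IsPullback j (c t) (ξ' t) (ξ t)
  maximal : ∀ (V : Set M') (α' : ∀ y : M', CotSpace E' y) (α : ∀ x : M, CotSpace E x), IsOpen V →
    T.SectionOn (j ⁻¹' V) α → (∀ x ∈ j ⁻¹' V, IsPullback j x (α' (j x)) (α x)) →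
    T'.SectionOn V α'

/-- `P' = dj ∘ P ∘ δj`: for every `x` in `M` and every `ξ'` in `T^♭_{j x} M'`, the pullback
`ξ = δj(x) ξ'` is in `T^♭_x M`, and `P' ξ' = d_x j (P ξ)`. -/
def IsProjectedAnchor {T : WeakSubbundle E M F} {T' : WeakSubbundle E' M' F'}
    (P : AlmostAnchor T) (P' : AlmostAnchor T') (j : M → M') : Prop :=
  ∀ (x : M) (ξ' : T'.fiber (j x)), ∃ ξ : T.fiber x,
    IsPullback j x ξ'.1 ξ.1 ∧ P'.toFun (j x) ξ' = dMap j x (P.toFun x ξ)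

end Distributions

end PartialPoisson

end

open PartialPoisson

open scoped ContDiff

noncomputable section

/-! The anchor on the quotient is forced. A covector at `j x` has a unique pullback to `x`, which
lies in `T` by `IsInduced.pullback_smooth`; its image under `P`, pushed down by the tangent map, has
to be the value. Surjectivity of `j` then gives uniqueness. Independence of the point in the fibre
is (PpP): the covector extends to a local section of `T'`, the pullback of that section is
projectable, and the fibre is a leaf (`MapsProjectable.dMap_eq`). Antisymmetry descends because
pullback is adjoint to the tangent map. For smoothness, a curve in the quotient lifts locally
through the submersion (`IsSubmersion.exists_lift`), and along the lift pullback, `P` and the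
tangent map all preserve smooth curves.

The Poisson property passes through functions. For open `V`, `f` is admissible on `V` exactly when
`f ∘ j` is admissible on `j ⁻¹' V`: one direction is condition (a), the other uses lifts of curves
and condition (b). By the chain rule brackets commute with this pullback (`IsInduced.bracket_comp`),
so closure under the bracket and the Jacobi identity are inherited from `M`.

All this rests on a calculus in which only smoothness along curves is given; the chain rule,
linearity of derivatives and smoothness of tangent maps have to be proved. In a convenient space
smoothness of curves can be tested by continuous linear forms (`curveSmoothOn_iff_dual`): weakly
bounded sets are bounded, so difference quotients are Mackey–Cauchy. Applied to two-parameter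
families, this reduces the calculus to functions of two real variables that are smooth along smooth
curves, for which two facts are needed: the derivative along the diagonal is the sum of the partial
derivatives (`PlanarSmooth.deriv_diag`), and the transversal derivative along a slice is smooth
(`PlanarSmooth.contDiff_deriv`). The special curve lemma bounds directional derivatives locally, and
Kemperman's identity turns these bounds into bounds on mixed differences, which yield both facts. -/

namespace PartialPoisson

/-! ### Derivatives of curves in topological vector spaces. -/

section TVS

variable {E : Type*} [AddCommGroup E] [Module ℝ E] [TopologicalSpace E]

theorem deriv_congr_nhds {c c' : ℝ → E} {t : ℝ} (h : c =ᶠ[𝓝 t] c') : deriv c t = deriv c' t := by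
  unfold deriv
  rw [h.fderiv_eq]

theorem iterate_deriv_congr_nhds {c c' : ℝ → E} {t : ℝ} (h : c =ᶠ[𝓝 t] c') (n : ℕ) :
    deriv^[n] c =ᶠ[𝓝 t] deriv^[n] c' := by
  induction n with
  | zero => exact h
  | succ n ih =>
    rw [Function.iterate_succ_apply', Function.iterate_succ_apply']
    filter_upwards [eventually_eventually_nhds.2 ih] with s hs using deriv_congr_nhds hs

/-- Iterated derivatives depend only on germs. This is what allows local lifts, local charts and
cut-offs to be used when a curve is tested for smoothness. -/
theorem CurveSmoothOn.of_locally {J : Set ℝ} {c : ℝ → E}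
    (h : ∀ t ∈ J, ∃ (J' : Set ℝ) (c' : ℝ → E), t ∈ J' ∧ CurveSmoothOn J' c' ∧ c =ᶠ[𝓝 t] c') :
    CurveSmoothOn J c := by
  intro n t ht
  obtain ⟨J', c', htJ, hc', hcc⟩ := h t ht
  obtain ⟨f', hf'⟩ := hc' n t htJ
  exact ⟨f', hf'.congr_of_eventuallyEq (iterate_deriv_congr_nhds hcc n)⟩

theorem CurveSmoothOn.mono {J J' : Set ℝ} {c : ℝ → E} (h : CurveSmoothOn J c) (hJ : J' ⊆ J) :
    CurveSmoothOn J' c := fun n t ht => h n t (hJ ht)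

theorem CurveSmoothOn.congr {J : Set ℝ} {c c' : ℝ → E} (hJ : IsOpen J) (h : CurveSmoothOn J c)
    (hcc : ∀ t ∈ J, c' t = c t) : CurveSmoothOn J c' :=
  .of_locally fun _ ht => ⟨J, c, ht, h, eventually_of_mem (hJ.mem_nhds ht) hcc⟩

theorem CurveSmoothOn.deriv {J : Set ℝ} {c : ℝ → E} (h : CurveSmoothOn J c) :
    CurveSmoothOn J (_root_.deriv c) := fun n t ht => h (n + 1) t ht

theorem curveSmoothOn_const (J : Set ℝ) (v : E) : CurveSmoothOn J (fun _ => v) := by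
  have hd : ∀ w : E, deriv (fun _ : ℝ => w) = fun _ => 0 := by
    intro w
    funext t
    -- Derivatives need not be unique here, as `E` is not assumed Hausdorff; but `fderiv` is by
    -- definition `0` whenever `0` is a derivative.
    simp only [_root_.deriv, fderiv, fderivWithin]
    rw [if_pos (hasFDerivAt_const w t).hasFDerivWithinAt]
    simp
  have hn : ∀ n : ℕ, ∃ w : E, deriv^[n] (fun _ : ℝ => v) = fun _ => w := by
    intro n
    induction n with
    | zero => exact ⟨v, rfl⟩
    | succ n ih =>
      obtain ⟨w, hw⟩ := ih
      exact ⟨0, by rw [Function.iterate_succ_apply', hw, hd]⟩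
  intro n t _
  obtain ⟨w, hw⟩ := hn n
  rw [hw]
  exact ⟨0, hasFDerivAt_const w t⟩

variable [IsTopologicalAddGroup E] [ContinuousSMul ℝ E]

theorem hasDerivAt_iff_tendsto_slope_tvs {c : ℝ → E} {d : E} {t : ℝ} :
    HasDerivAt c d t ↔ Tendsto (fun h : ℝ => h⁻¹ • (c (t + h) - c t)) (𝓝[≠] 0) (𝓝 d) := by
  rw [hasDerivAt_iff_hasFDerivAt, hasFDerivAt_iff_isLittleOTVS,
    Asymptotics.isLittleOTVS_iff_tendsto_inv_smul (by
      refine Eventually.of_forall fun x hx => ?_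
      rw [sub_eq_zero] at hx
      simp [hx])]
  have h1 : (𝓝 t) = map (fun h => t + h) (𝓝 0) := by simp
  rw [h1, tendsto_map'_iff]
  have h2 : Tendsto (fun h : ℝ => h⁻¹ • (c (t + h) - c t)) (𝓝[≠] 0) (𝓝 d) ↔
      Tendsto (fun h : ℝ => h⁻¹ • (c (t + h) - c t) - d) (𝓝[≠] 0) (𝓝 0) :=
    tendsto_sub_nhds_zero_iff.symm
  -- The point `h = 0` may be dropped from the filter: there `h⁻¹ = 0`, so the expression vanishes.
  rw [h2, ← tendsto_inf_principal_nhds_iff_of_forall_eq (l := 𝓝 0) (s := {0}ᶜ)]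
  · refine tendsto_congr' ?_
    filter_upwards [self_mem_nhdsWithin] with h hh
    have : h ≠ 0 := hh
    simp [smul_sub, this]
  · simp

omit [IsTopologicalAddGroup E] in
theorem _root_.DifferentiableAt.hasDerivAt_tvs {c : ℝ → E} {t : ℝ} (h : DifferentiableAt ℝ c t) :
    HasDerivAt c (deriv c t) t :=
  h.hasFDerivAt.hasDerivAt

theorem _root_.HasDerivAt.continuousAt_tvs {c : ℝ → E} {d : E} {t : ℝ} (h : HasDerivAt c d t) :
    ContinuousAt c t := h.hasFDerivAt.continuousAt

omit [IsTopologicalAddGroup E] in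
theorem _root_.HasDerivAt.congr_tvs {c c' : ℝ → E} {d : E} {t : ℝ} (h : HasDerivAt c d t)
    (hc : c' =ᶠ[𝓝 t] c) : HasDerivAt c' d t :=
  h.hasFDerivAt.congr_of_eventuallyEq hc

theorem _root_.HasDerivAt.unique_tvs [T2Space E] {c : ℝ → E} {d d' : E} {t : ℝ} (h : HasDerivAt c d t)
    (h' : HasDerivAt c d' t) : d = d' := by
  rw [hasDerivAt_iff_tendsto_slope_tvs] at h h'
  exact tendsto_nhds_unique h h'

theorem _root_.HasDerivAt.deriv_tvs [T2Space E] {c : ℝ → E} {d : E} {t : ℝ} (h : HasDerivAt c d t) :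
    deriv c t = d :=
  (DifferentiableAt.hasDerivAt_tvs ⟨_, h.hasFDerivAt⟩).unique_tvs h

theorem _root_.HasDerivAt.clm_comp_tvs {c : ℝ → E} {d : E} {t : ℝ} (h : HasDerivAt c d t) (l : E →L[ℝ] ℝ) :
    HasDerivAt (fun s => l (c s)) (l d) t := by
  rw [hasDerivAt_iff_tendsto_slope_tvs] at h ⊢
  have := (l.continuous.tendsto d).comp h
  simpa [Function.comp_def] using this

theorem CurveSmoothOn.continuousOn {J : Set ℝ} {c : ℝ → E} (h : CurveSmoothOn J c) :
    ContinuousOn c J := fun t ht =>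
  (DifferentiableAt.hasDerivAt_tvs (h 0 t ht)).continuousAt_tvs.continuousWithinAt

theorem contDiffOn_of_curveSmoothOn {J : Set ℝ} (hJ : IsOpen J) {c : ℝ → E}
    (h : CurveSmoothOn J c) (l : E →L[ℝ] ℝ) : ContDiffOn ℝ ∞ (fun s => l (c s)) J := by
  rw [contDiffOn_infty]
  intro n
  induction n generalizing c with
  | zero =>
    rw [Nat.cast_zero, contDiffOn_zero]
    exact l.continuous.comp_continuousOn h.continuousOn
  | succ n ih =>
    have hd : ∀ t ∈ J, HasDerivAt (fun s => l (c s)) (l (_root_.deriv c t)) t := fun t ht =>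
      (DifferentiableAt.hasDerivAt_tvs (h 0 t ht)).clm_comp_tvs l
    rw [Nat.cast_succ, contDiffOn_succ_iff_deriv_of_isOpen hJ]
    refine ⟨fun t ht => (hd t ht).differentiableAt.differentiableWithinAt, by simp, ?_⟩
    exact (ih h.deriv).congr fun t ht => (hd t ht).deriv

end TVS

theorem curveSmoothOn_real_iff {J : Set ℝ} (hJ : IsOpen J) {g : ℝ → ℝ} :
    CurveSmoothOn J g ↔ ContDiffOn ℝ ∞ g J := by
  refine ⟨fun h => contDiffOn_of_curveSmoothOn hJ h (ContinuousLinearMap.id ℝ ℝ), fun h n => ?_⟩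
  induction n generalizing g with
  | zero => exact fun t ht => (h.differentiableOn (by simp)).differentiableAt (hJ.mem_nhds ht)
  | succ n ih => exact ih ((contDiffOn_infty_iff_deriv_of_isOpen hJ).1 h).2

/-! ### Mackey's theorem: weakly bounded sets are bounded. -/

section Mackey

/-- The space `E`, to be equipped with the seminorm `p`. -/
def SeminormCopy {E : Type*} [AddCommGroup E] [Module ℝ E] (_ : Seminorm ℝ E) : Type _ := E

variable {E : Type*} [AddCommGroup E] [Module ℝ E]

instance (p : Seminorm ℝ E) : SeminormedAddCommGroup (SeminormCopy p) :=
  p.toAddGroupSeminorm.toSeminormedAddCommGroup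

instance (p : Seminorm ℝ E) : NormedSpace ℝ (SeminormCopy p) where
  toModule := inferInstanceAs (Module ℝ E)
  norm_smul_le := fun a b => (map_smul_eq_mul p a b).le

/-- The identity from `E` to `E` with the seminorm `p`. -/
def toSeminormCopy [TopologicalSpace E] [IsTopologicalAddGroup E] (p : Seminorm ℝ E)
    (hp : Continuous p) : E →L[ℝ] SeminormCopy p where
  toFun := fun v => v
  map_add' := fun _ _ => rfl
  map_smul' := fun _ _ => rfl
  cont := by
    refine continuous_iff_continuousAt.2 fun v => ?_
    refine tendsto_iff_norm_sub_tendsto_zero.2 ?_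
    have h : Tendsto (fun w : E => p (w - v)) (𝓝 v) (𝓝 (p (v - v))) :=
      (hp.comp (continuous_id.sub continuous_const)).tendsto v
    rwa [sub_self, map_zero] at h

/-- Uniform boundedness principle for the evaluations at the points of `B`. They act on the dual of
`V`, which is complete even if `V` is not, and their operator norms are the norms of the points. -/
theorem exists_norm_le_of_forall_dual {V : Type*} [SeminormedAddCommGroup V] [NormedSpace ℝ V]
    {B : Set V} (h : ∀ l : V →L[ℝ] ℝ, ∃ C, ∀ x ∈ B, |l x| ≤ C) : ∃ C, ∀ x ∈ B, ‖x‖ ≤ C := by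
  obtain ⟨C, hC⟩ := banach_steinhaus
    (g := fun x : B => NormedSpace.inclusionInDoubleDualLi ℝ (E := V) (x : V)) (fun l => by
      obtain ⟨C, hC⟩ := h l
      exact ⟨C, fun x => hC x x.2⟩)
  exact ⟨C, fun x hx =>
    ((NormedSpace.inclusionInDoubleDualLi ℝ).norm_map x).symm.le.trans (hC ⟨x, hx⟩)⟩

/-- A set on which every continuous linear form is bounded is bounded. -/
theorem isVonNBounded_of_forall_dual [TopologicalSpace E] [IsTopologicalAddGroup E]
    [ContinuousSMul ℝ E] [LocallyConvexSpace ℝ E]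
    {B : Set E} (h : ∀ l : E →L[ℝ] ℝ, ∃ C, ∀ x ∈ B, |l x| ≤ C) : Bornology.IsVonNBounded ℝ B := by
  rw [(with_gaugeSeminormFamily (𝕜 := ℝ) (E := E)).isVonNBounded_iff_seminorm_bounded]
  intro i
  set p := gaugeSeminormFamily ℝ E i
  have hpc : Continuous p := with_gaugeSeminormFamily.continuous_seminorm i
  -- A form continuous for one of the defining seminorms is continuous on `E`, so the seminorms can
  -- be treated one at a time.
  obtain ⟨C, hC⟩ := exists_norm_le_of_forall_dual (B := toSeminormCopy p hpc '' B) (fun l => by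
    obtain ⟨C, hC⟩ := h (l.comp (toSeminormCopy p hpc))
    exact ⟨C, by rintro _ ⟨x, hx, rfl⟩; exact hC x hx⟩)
  exact ⟨max C 0 + 1, by positivity, fun x hx =>
    (hC _ ⟨x, hx, rfl⟩).trans_lt (lt_of_le_of_lt (le_max_left C 0) (lt_add_one _))⟩

theorem exists_abs_le_of_isVonNBounded [TopologicalSpace E] [IsTopologicalAddGroup E]
    [ContinuousSMul ℝ E] {B : Set E} (h : Bornology.IsVonNBounded ℝ B) (l : E →L[ℝ] ℝ) :
    ∃ C, ∀ x ∈ B, |l x| ≤ C := by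
  have := h.image l
  rw [NormedSpace.isVonNBounded_iff, isBounded_iff_forall_norm_le] at this
  obtain ⟨C, hC⟩ := this
  exact ⟨C, fun x hx => hC _ ⟨x, hx, rfl⟩⟩

end Mackey

/-! ### Quadratic Taylor remainders of real functions. -/

section Scalar

theorem abs_taylor_le {J : Set ℝ} (hJ : IsOpen J) {g : ℝ → ℝ} (hg : ContDiffOn ℝ ∞ g J)
    {t δ C : ℝ} (hδ : Icc (t - δ) (t + δ) ⊆ J) (hC0 : 0 ≤ C)
    (hC : ∀ x ∈ Icc (t - δ) (t + δ), |deriv (deriv g) x| ≤ C) {h : ℝ} (hh : |h| ≤ δ) :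
    |g (t + h) - g t - h * deriv g t| ≤ C * h ^ 2 := by
  have hg1 := ((contDiffOn_infty_iff_deriv_of_isOpen hJ).1 hg)
  have hg2 := ((contDiffOn_infty_iff_deriv_of_isOpen hJ).1 hg1.2)
  have hd1 : ∀ x ∈ J, HasDerivAt g (deriv g x) x := fun x hx =>
    ((hg1.1 x hx).differentiableAt (hJ.mem_nhds hx)).hasDerivAt
  have hd2 : ∀ x ∈ J, HasDerivAt (deriv g) (deriv (deriv g) x) x := fun x hx =>
    ((hg2.1 x hx).differentiableAt (hJ.mem_nhds hx)).hasDerivAt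
  have hsub : uIcc t (t + h) ⊆ Icc (t - δ) (t + δ) := by
    intro x hx
    rw [abs_le] at hh
    rw [mem_uIcc] at hx
    constructor <;> rcases hx with hx | hx <;> linarith [hx.1, hx.2]
  have hconv : Convex ℝ (uIcc t (t + h)) := convex_uIcc _ _
  have hb1 : ∀ x ∈ uIcc t (t + h), ‖deriv g x - deriv g t‖ ≤ C * |h| := by
    intro x hx
    have h1 := hconv.norm_image_sub_le_of_norm_hasDerivWithin_le (f := deriv g)
      (fun y hy => (hd2 y (hδ (hsub hy))).hasDerivWithinAt)
      (fun y hy => hC y (hsub hy)) left_mem_uIcc hx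
    refine h1.trans (mul_le_mul_of_nonneg_left ?_ hC0)
    have := abs_sub_left_of_mem_uIcc hx
    simpa using this
  -- Second use of the mean value inequality, after subtracting the linear part. The factor `1/2` of
  -- Taylor's formula is not needed.
  have h2 := hconv.norm_image_sub_le_of_norm_hasDerivWithin_le
    (f := fun x => g x - x * deriv g t) (f' := fun x => deriv g x - deriv g t)
    (fun y hy => by
      have := (hd1 y (hδ (hsub hy))).sub ((hasDerivAt_id y).mul_const (deriv g t))
      rw [one_mul] at this
      exact this.hasDerivWithinAt)
    hb1 left_mem_uIcc right_mem_uIcc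
  simp only [Real.norm_eq_abs, add_sub_cancel_left] at h2
  calc |g (t + h) - g t - h * deriv g t|
      = |g (t + h) - (t + h) * deriv g t - (g t - t * deriv g t)| := by ring_nf
    _ ≤ C * |h| * |h| := h2
    _ = C * h ^ 2 := by rw [mul_assoc, abs_mul_abs_self, sq]

theorem exists_abs_taylor_le {J : Set ℝ} (hJ : IsOpen J) {g : ℝ → ℝ} (hg : ContDiffOn ℝ ∞ g J)
    {t δ : ℝ} (hδ : Icc (t - δ) (t + δ) ⊆ J) :
    ∃ C, 0 ≤ C ∧ ∀ h, |h| ≤ δ → |g (t + h) - g t - h * deriv g t| ≤ C * h ^ 2 := by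
  have hg1 := ((contDiffOn_infty_iff_deriv_of_isOpen hJ).1 hg)
  have hg2 := ((contDiffOn_infty_iff_deriv_of_isOpen hJ).1 hg1.2)
  obtain ⟨C, hC⟩ := (isCompact_Icc (a := t - δ) (b := t + δ)).exists_bound_of_continuousOn
    (hg2.2.continuousOn.mono hδ)
  exact ⟨max C 0, le_max_right _ _, fun h hh => abs_taylor_le hJ hg hδ (le_max_right _ _)
    (fun x hx => (hC x hx).trans (le_max_left C 0)) hh⟩

end Scalar

/-! ### Scalarwise smooth curves in convenient spaces; bounded linear maps. -/

section Convenient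

variable {E : Type*} [AddCommGroup E] [Module ℝ E] [TopologicalSpace E] [ConvenientSpace E]

/-- A curve that is scalarwise differentiable with a quadratic remainder is differentiable, with
a bounded remainder. -/
theorem exists_hasDerivAt_of_forall_dual {c : ℝ → E} {t δ : ℝ} (hδ : 0 < δ)
    (h : ∀ l : E →L[ℝ] ℝ, ∃ D C, 0 ≤ C ∧
      ∀ s, |s| ≤ δ → |l (c (t + s)) - l (c t) - s * D| ≤ C * s ^ 2) :
    ∃ d, HasDerivAt c d t ∧ ∃ B : Set E, Bornology.IsVonNBounded ℝ B ∧
      ∀ s, |s| ≤ δ → s ≠ 0 → s⁻¹ • (s⁻¹ • (c (t + s) - c t) - d) ∈ B := by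
  choose D C hC0 hC using h
  have hC' : ∀ l s, |s| ≤ δ → s ≠ 0 → |l (s⁻¹ • (c (t + s) - c t)) - D l| ≤ C l * |s| := by
    intro l s hs hs0
    have h1 : l (s⁻¹ • (c (t + s) - c t)) - D l =
        s⁻¹ * (l (c (t + s)) - l (c t) - s * D l) := by
      simp only [map_smul, map_sub, smul_eq_mul]
      field_simp
    rw [h1, abs_mul, abs_inv]
    calc |s|⁻¹ * |l (c (t + s)) - l (c t) - s * D l| ≤ |s|⁻¹ * (C l * s ^ 2) :=
          mul_le_mul_of_nonneg_left (hC l s hs) (by positivity)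
      _ = C l * |s| := by
          rw [← sq_abs s]
          have : |s| ≠ 0 := abs_ne_zero.2 hs0
          field_simp
  -- The set defined by all the scalar remainder estimates at once. It is bounded by Mackey's
  -- theorem, and it serves both as the set for the Mackey–Cauchy condition and as the bound on the
  -- remainder.
  set B : Set E := {x | ∀ l : E →L[ℝ] ℝ, |l x| ≤ C l} with hB
  have hBb : Bornology.IsVonNBounded ℝ B :=
    isVonNBounded_of_forall_dual fun l => ⟨C l, fun x hx => hx l⟩
  have hBa : AbsConvex ℝ B := by
    constructor
    · rintro a ha _ ⟨x, hx, rfl⟩ l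
      simp only [map_smul, smul_eq_mul, abs_mul]
      rw [Real.norm_eq_abs] at ha
      nlinarith [hx l, abs_nonneg a, abs_nonneg (l x), hC0 l]
    · intro x hx y hy a b ha hb hab l
      simp only [map_add, map_smul, smul_eq_mul]
      calc |a * l x + b * l y| ≤ |a * l x| + |b * l y| := abs_add_le _ _
        _ = a * |l x| + b * |l y| := by rw [abs_mul, abs_mul, abs_of_nonneg ha, abs_of_nonneg hb]
        _ ≤ a * C l + b * C l := by
          gcongr
          · exact hx l
          · exact hy l
        _ = C l := by rw [← add_mul, hab, one_mul]
  -- The quotients with steps `η m` and `η n` differ by an element of `(η m + η n) • B`, hence they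
  -- form a Mackey–Cauchy sequence; its limit is the only candidate for the derivative.
  set η : ℕ → ℝ := fun n => δ * (1 / ((n : ℝ) + 1)) with hη
  have hη0 : ∀ n, 0 < η n := fun n => by positivity
  have hηδ : ∀ n, |η n| ≤ δ := fun n => by
    rw [abs_of_pos (hη0 n)]
    have : 1 / ((n : ℝ) + 1) ≤ 1 := by
      rw [div_le_one (by positivity)]
      linarith [Nat.cast_nonneg (α := ℝ) n]
    exact (mul_le_mul_of_nonneg_left this hδ.le).trans_eq (mul_one δ)
  have hηt : Tendsto η atTop (𝓝 0) := by
    have := (tendsto_one_div_add_atTop_nhds_zero_nat (𝕜 := ℝ)).const_mul δ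
    rwa [mul_zero] at this
  obtain ⟨y, hy⟩ := ConvenientSpace.mackey_complete
    (fun n => (η n)⁻¹ • (c (t + η n) - c t)) ⟨B, hBb, hBa, fun ε hε => by
      obtain ⟨N, hN⟩ := eventually_atTop.1 (hηt.eventually_lt_const (half_pos hε))
      refine ⟨N, fun m n hm hn => ?_⟩
      rw [mem_smul_set_iff_inv_smul_mem₀ hε.ne']
      intro l
      have h1 := hC' l (η m) (hηδ m) (hη0 m).ne'
      have h2 := hC' l (η n) (hηδ n) (hη0 n).ne'
      rw [abs_of_pos (hη0 _)] at h1 h2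
      have h3 := hN m hm.le
      have h4 := hN n (hm.trans hn).le
      rw [map_smul, map_sub, smul_eq_mul, abs_mul, abs_inv, abs_of_pos hε, inv_mul_le_iff₀ hε]
      rw [abs_le] at h1 h2 ⊢
      constructor <;> nlinarith [hC0 l]⟩
  have hly : ∀ l : E →L[ℝ] ℝ, l y = D l := by
    intro l
    have h1 : Tendsto (fun n => l ((η n)⁻¹ • (c (t + η n) - c t))) atTop (𝓝 (l y)) :=
      (l.continuous.tendsto y).comp hy
    have h2 : Tendsto (fun n => l ((η n)⁻¹ • (c (t + η n) - c t))) atTop (𝓝 (D l)) := by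
      rw [tendsto_iff_norm_sub_tendsto_zero]
      refine squeeze_zero (fun n => norm_nonneg _)
        (fun n => hC' l (η n) (hηδ n) (hη0 n).ne') ?_
      simpa using hηt.abs.const_mul (C l)
    exact tendsto_nhds_unique h1 h2
  have hmem : ∀ s, |s| ≤ δ → s ≠ 0 → s⁻¹ • (s⁻¹ • (c (t + s) - c t) - y) ∈ B := by
    intro s hs hs0 l
    have h1 := hC' l s hs hs0
    rw [map_smul, map_sub, hly, smul_eq_mul, abs_mul, abs_inv,
      inv_mul_le_iff₀ (abs_pos.2 hs0), mul_comm]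
    exact h1
  refine ⟨y, ?_, B, hBb, hmem⟩
  rw [hasDerivAt_iff_tendsto_slope_tvs, ← tendsto_sub_nhds_zero_iff]
  have hev : ∀ᶠ s : ℝ in 𝓝[≠] 0, |s| ≤ δ ∧ s ≠ 0 := by
    filter_upwards [nhdsWithin_le_nhds (Metric.closedBall_mem_nhds (0 : ℝ) hδ),
      self_mem_nhdsWithin] with s hs hs0
    exact ⟨by simpa using hs, hs0⟩
  have h1 := hBb.smul_tendsto_zero (l := 𝓝[≠] (0 : ℝ)) (ε := fun s => s)
    (x := fun s => s⁻¹ • (s⁻¹ • (c (t + s) - c t) - y))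
    (hev.mono fun s hs => hmem s hs.1 hs.2) (tendsto_id.mono_left nhdsWithin_le_nhds)
  refine h1.congr' (hev.mono fun s hs => ?_)
  simp [smul_inv_smul₀ hs.2]

/-- The bounded remainder is recorded besides the derivative because it is what lets bounded,
possibly discontinuous, linear maps commute with differentiation. -/
theorem exists_hasDerivAt_of_contDiffOn_dual {J : Set ℝ} (hJ : IsOpen J) {c : ℝ → E}
    (h : ∀ l : E →L[ℝ] ℝ, ContDiffOn ℝ ∞ (fun s => l (c s)) J) {t : ℝ} (ht : t ∈ J) :
    ∃ d, HasDerivAt c d t ∧ ∃ δ > 0, ∃ B : Set E, Bornology.IsVonNBounded ℝ B ∧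
      ∀ s, |s| ≤ δ → s ≠ 0 → s⁻¹ • (s⁻¹ • (c (t + s) - c t) - d) ∈ B := by
  obtain ⟨δ, hδ, hδJ⟩ := Metric.nhds_basis_closedBall.mem_iff.1 (hJ.mem_nhds ht)
  rw [Real.closedBall_eq_Icc] at hδJ
  obtain ⟨d, hd, hB⟩ := exists_hasDerivAt_of_forall_dual (c := c) (t := t) hδ fun l => by
    obtain ⟨C, hC0, hC⟩ := exists_abs_taylor_le hJ (h l) hδJ
    exact ⟨_, C, hC0, hC⟩
  exact ⟨d, hd, δ, hδ, hB⟩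

/-- In a convenient space a curve is smooth as soon as it is scalarwise smooth. -/
theorem curveSmoothOn_iff_dual {J : Set ℝ} (hJ : IsOpen J) {c : ℝ → E} :
    CurveSmoothOn J c ↔ ∀ l : E →L[ℝ] ℝ, ContDiffOn ℝ ∞ (fun s => l (c s)) J := by
  refine ⟨fun h l => contDiffOn_of_curveSmoothOn hJ h l, fun h n => ?_⟩
  induction n generalizing c with
  | zero =>
    intro t ht
    obtain ⟨d, hd, -⟩ := exists_hasDerivAt_of_contDiffOn_dual hJ h ht
    exact ⟨_, hd.hasFDerivAt⟩
  | succ n ih =>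
    refine ih fun l => ?_
    refine ((contDiffOn_infty_iff_deriv_of_isOpen hJ).1 (h l)).2.congr fun t ht => ?_
    obtain ⟨d, hd, -⟩ := exists_hasDerivAt_of_contDiffOn_dual hJ h ht
    rw [hd.deriv_tvs, (hd.clm_comp_tvs l).deriv]

theorem curveSmoothOn_univ_iff_dual {c : ℝ → E} :
    CurveSmoothOn univ c ↔ ∀ l : E →L[ℝ] ℝ, ContDiff ℝ ∞ (fun s => l (c s)) := by
  rw [curveSmoothOn_iff_dual isOpen_univ]
  simp only [contDiffOn_univ]

instance : ConvenientSpace ℝ where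
  mackey_complete := by
    rintro x ⟨B, hB, -, h⟩
    rw [NormedSpace.isVonNBounded_iff, isBounded_iff_forall_norm_le] at hB
    obtain ⟨C, hC⟩ := hB
    refine cauchySeq_tendsto_of_complete (Metric.cauchySeq_iff'.2 fun ε hε => ?_)
    have hC1 : 0 < max C 0 + 1 := by positivity
    obtain ⟨N, hN⟩ := h (ε / (max C 0 + 1)) (by positivity)
    -- The Mackey condition only concerns indices with `N < m < n`, so the comparison index is `N +
    -- 1`, and `n = N + 1` is treated apart.
    refine ⟨N + 1, fun n hn => ?_⟩
    rcases hn.eq_or_lt with rfl | hn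
    · simpa using hε
    obtain ⟨b, hb, hbe⟩ := hN (N + 1) n (Nat.lt_succ_self N) hn
    rw [dist_comm, dist_eq_norm, ← hbe]
    simp only [smul_eq_mul, norm_mul, Real.norm_eq_abs, abs_of_pos (div_pos hε hC1)]
    have h1 : |b| < max C 0 + 1 := lt_of_le_of_lt ((hC b hb).trans (le_max_left C 0)) (lt_add_one _)
    calc ε / (max C 0 + 1) * |b| < ε / (max C 0 + 1) * (max C 0 + 1) := by gcongr
      _ = ε := by field_simp

/-- The difference quotient with step `s` differs from the derivative by `s` times an element of a
fixed bounded set; `L` maps that set to a bounded set, so the error still tends to `0` although `L`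
may be discontinuous. -/
theorem contDiffOn_boundedLinear_comp {J : Set ℝ} (hJ : IsOpen J) {c : ℝ → E}
    (hc : CurveSmoothOn J c) {L : E →ₗ[ℝ] ℝ} (hL : BoundedLinear L) :
    ContDiffOn ℝ ∞ (fun s => L (c s)) J := by
  have key : ∀ {c : ℝ → E}, CurveSmoothOn J c → ∀ t ∈ J,
      HasDerivAt (fun s => L (c s)) (L (deriv c t)) t := by
    intro c hc t ht
    obtain ⟨d, hd, δ, hδ, B, hB, hmem⟩ :=
      exists_hasDerivAt_of_contDiffOn_dual hJ ((curveSmoothOn_iff_dual hJ).1 hc) ht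
    rw [hd.deriv_tvs, hasDerivAt_iff_tendsto_slope_tvs, ← tendsto_sub_nhds_zero_iff]
    have hev : ∀ᶠ s : ℝ in 𝓝[≠] 0, |s| ≤ δ ∧ s ≠ 0 := by
      filter_upwards [nhdsWithin_le_nhds (Metric.closedBall_mem_nhds (0 : ℝ) hδ),
        self_mem_nhdsWithin] with s hs hs0
      exact ⟨by simpa using hs, hs0⟩
    have h1 := (hL B hB).smul_tendsto_zero (l := 𝓝[≠] (0 : ℝ)) (ε := fun s => s)
      (x := fun s => L (s⁻¹ • (s⁻¹ • (c (t + s) - c t) - d)))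
      (hev.mono fun s hs => ⟨_, hmem s hs.1 hs.2, rfl⟩) (tendsto_id.mono_left nhdsWithin_le_nhds)
    refine h1.congr' (hev.mono fun s hs => ?_)
    simp only [Pi.smul_apply', map_smul, map_sub, smul_inv_smul₀ hs.2]
  rw [contDiffOn_infty]
  intro n
  induction n generalizing c with
  | zero =>
    rw [Nat.cast_zero, contDiffOn_zero]
    exact fun t ht => (key hc t ht).continuousAt.continuousWithinAt
  | succ n ih =>
    rw [Nat.cast_succ, contDiffOn_succ_iff_deriv_of_isOpen hJ]
    exact ⟨fun t ht => (key hc t ht).differentiableAt.differentiableWithinAt, by simp,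
      (ih hc.deriv).congr fun t ht => (key hc t ht).deriv⟩

theorem BoundedLinear.comp_curveSmoothOn {E' : Type*} [AddCommGroup E'] [Module ℝ E']
    [TopologicalSpace E'] [ConvenientSpace E'] {J : Set ℝ} (hJ : IsOpen J) {c : ℝ → E}
    (hc : CurveSmoothOn J c) {L : E →ₗ[ℝ] E'} (hL : BoundedLinear L) :
    CurveSmoothOn J (fun s => L (c s)) := by
  rw [curveSmoothOn_iff_dual hJ]
  intro l
  refine contDiffOn_boundedLinear_comp hJ hc (L := (l : E' →ₗ[ℝ] ℝ) ∘ₗ L) fun B hB => ?_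
  have := (hL B hB).image l
  rwa [image_image] at this

end Convenient

/-! ### The special curve lemma. -/

section SpecialCurve

/-- Compactly supported smooth functions have arbitrarily bounded linear combinations that sum up
to smooth functions, once they are multiplied by small enough weights. -/
theorem exists_weights_contDiff_tsum {u w : ℕ → ℝ → ℝ} (hu : ∀ k, ContDiff ℝ ∞ (u k))
    (hw : ∀ k, ContDiff ℝ ∞ (w k)) (hu' : ∀ k, HasCompactSupport (u k))
    (hw' : ∀ k, HasCompactSupport (w k)) :
    ∃ a : ℕ → ℝ, (∀ k, 0 < a k) ∧ ∀ (p q : ℕ → ℝ) (C : ℝ), (∀ k, |p k| ≤ C) → (∀ k, |q k| ≤ C) →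
      ContDiff ℝ ∞ (fun t => ∑' k, a k * (p k * u k t + q k * w k t)) := by
  have key : ∀ {f : ℝ → ℝ}, ContDiff ℝ ∞ f → HasCompactSupport f → ∀ n : ℕ,
      ∃ C, ∀ x, ‖iteratedFDeriv ℝ n f x‖ ≤ C := fun hf hf' n =>
    (hf'.iteratedFDeriv n).exists_bound_of_continuous
      (hf.continuous_iteratedFDeriv (by exact_mod_cast le_top))
  choose A hA using fun k => key (hu k) (hu' k)
  choose B hB using fun k => key (hw k) (hw' k)
  -- `S k` dominates the derivatives of orders `n ≤ k` only. This is enough: for fixed `n` just the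
  -- finitely many terms with `k < n` escape the estimate by `C * (1 / 2) ^ k`.
  set S : ℕ → ℝ := fun k => 1 + ∑ n ∈ Finset.range (k + 1), (|A k n| + |B k n|) with hS
  have hS1 : ∀ k, 0 < S k := fun k => by positivity
  refine ⟨fun k => (1 / 2) ^ k / S k, fun k => div_pos (by positivity) (hS1 k),
    fun p q C hp hq => ?_⟩
  refine contDiff_tsum_of_eventually (N := ⊤) (v := fun _ k => C * (1 / 2) ^ k)
    (fun k => contDiff_const.mul ((contDiff_const.mul (hu k)).add (contDiff_const.mul (hw k))))
    (fun _ _ => (summable_geometric_of_lt_one (by norm_num) (by norm_num)).mul_left C)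
    (fun n _ => ?_)
  rw [Nat.cofinite_eq_atTop]
  filter_upwards [eventually_ge_atTop n] with k hk x
  have hun : ContDiffAt ℝ n (u k) x := ((hu k).of_le (by exact_mod_cast le_top)).contDiffAt
  have hwn : ContDiffAt ℝ n (w k) x := ((hw k).of_le (by exact_mod_cast le_top)).contDiffAt
  have hfun : (fun t => (1 / 2) ^ k / S k * (p k * u k t + q k * w k t)) =
      ((1 / 2) ^ k / S k) • (p k • u k + q k • w k) := rfl
  have hpu : ContDiffAt ℝ n (p k • u k) x := hun.const_smul (p k)
  have hqw : ContDiffAt ℝ n (q k • w k) x := hwn.const_smul (q k)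
  have hpq : ContDiffAt ℝ n (p k • u k + q k • w k) x := hpu.add hqw
  rw [hfun, iteratedFDeriv_const_smul_apply hpq, iteratedFDeriv_add_apply hpu hqw,
    iteratedFDeriv_const_smul_apply hun, iteratedFDeriv_const_smul_apply hwn, norm_smul,
    Real.norm_eq_abs, abs_of_pos (div_pos (by positivity) (hS1 k))]
  have hC : 0 ≤ C := (abs_nonneg _).trans (hp 0)
  have h1 : ‖p k • iteratedFDeriv ℝ n (u k) x + q k • iteratedFDeriv ℝ n (w k) x‖ ≤ C * S k := by
    refine (norm_add_le _ _).trans ?_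
    rw [norm_smul, norm_smul, Real.norm_eq_abs, Real.norm_eq_abs]
    have h2 : |A k n| + |B k n| ≤ S k := by
      have := Finset.single_le_sum (f := fun n => |A k n| + |B k n|)
        (fun i _ => by positivity) (Finset.mem_range.2 (Nat.lt_succ_of_le hk))
      simp only [hS]
      linarith
    calc _ ≤ C * |A k n| + C * |B k n| := by
          gcongr
          · exact hp k
          · exact (hA k n x).trans (le_abs_self _)
          · exact hq k
          · exact (hB k n x).trans (le_abs_self _)
      _ = C * (|A k n| + |B k n|) := by ring
      _ ≤ C * S k := by gcongr
  calc (1 / 2) ^ k / S k * _ ≤ (1 / 2) ^ k / S k * (C * S k) := by gcongr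
    _ = C * (1 / 2) ^ k := by
      have := (hS1 k).ne'
      field_simp

theorem exists_disjoint_bumps : ∃ (τ : ℕ → ℝ) (θ : ℕ → ℝ → ℝ), Tendsto τ atTop (𝓝 0) ∧
    (∀ k, ContDiff ℝ ∞ (θ k)) ∧ (∀ k, HasCompactSupport (θ k)) ∧ (∀ k, ∀ᶠ t in 𝓝 (τ k), θ k t = 1) ∧
    (∀ k, θ k 0 = 0) ∧ ∀ k m t, θ k t ≠ 0 → θ m t ≠ 0 → k = m := by
  have hpos : ∀ k : ℕ, 0 < (1 / 2 : ℝ) ^ k := fun k => by positivity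
  -- The bump at `2⁻ᵏ` lives above `(3/4) * 2⁻ᵏ`, the next one below `(5/8) * 2⁻ᵏ`; hence the
  -- supports are disjoint and avoid `0`.
  let b : ∀ k : ℕ, ContDiffBump ((1 / 2 : ℝ) ^ k) := fun k =>
    { rIn := (1 / 2) ^ k / 8
      rOut := (1 / 2) ^ k / 4
      rIn_pos := by have := hpos k; positivity
      rIn_lt_rOut := by have := hpos k; linarith }
  have hsupp : ∀ k t, b k t ≠ 0 → |t - (1 / 2) ^ k| < (1 / 2) ^ k / 4 := fun k t ht => by
    have : t ∈ Function.support (b k) := ht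
    rw [(b k).support_eq] at this
    rwa [Metric.mem_ball, Real.dist_eq] at this
  have hlt : ∀ k m t, b k t ≠ 0 → b m t ≠ 0 → ¬ k < m := fun k m t hk hm hkm => by
    have h1 := hsupp k t hk
    have h2 := hsupp m t hm
    have h3 : (1 / 2 : ℝ) ^ m ≤ (1 / 2) ^ (k + 1) :=
      pow_le_pow_of_le_one (by norm_num) (by norm_num) hkm
    rw [pow_succ] at h3
    rw [abs_lt] at h1 h2
    linarith [h1.1, h2.2, hpos k]
  refine ⟨fun k => (1 / 2) ^ k, fun k => b k, tendsto_pow_atTop_nhds_zero_of_lt_one (by norm_num)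
    (by norm_num), fun k => (b k).contDiff, fun k => (b k).hasCompactSupport, fun k =>
    (b k).eventuallyEq_one, fun k => ?_, fun k m t hk hm => ?_⟩
  · by_contra h
    have h1 := hsupp k 0 h
    have := hpos k
    rw [zero_sub, abs_neg, abs_of_pos this] at h1
    linarith
  · exact le_antisymm (not_lt.1 (hlt m k t hm hk)) (not_lt.1 (hlt k m t hk hm))

/-- The special curve lemma: fast falling affine germs are met by one smooth curve. -/
theorem exists_special_curve : ∃ a τ : ℕ → ℝ, (∀ k, 0 < a k) ∧ Tendsto τ atTop (𝓝 0) ∧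
    ∀ {E : Type*} [AddCommGroup E] [Module ℝ E] [TopologicalSpace E] [ConvenientSpace E]
      (B : Set E), Bornology.IsVonNBounded ℝ B → ∀ p q : ℕ → E, (∀ k, p k ∈ B) → (∀ k, q k ∈ B) →
      ∃ c : ℝ → E, CurveSmoothOn univ c ∧ c 0 = 0 ∧
        ∀ k, ∀ᶠ t in 𝓝 (τ k), c t = a k • (p k + (t - τ k) • q k) := by
  obtain ⟨τ, θ, hτ, hθ, hθc, hθ1, hθ0, hθd⟩ := exists_disjoint_bumps
  obtain ⟨a, ha, hsum⟩ := exists_weights_contDiff_tsum (u := θ)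
    (w := fun k t => (t - τ k) * θ k t) hθ
    (fun k => (contDiff_id.sub contDiff_const).mul (hθ k)) hθc (fun k => (hθc k).mul_left)
  refine ⟨a, τ, ha, hτ, fun {E} _ _ _ _ B hB p q hp hq => ?_⟩
  have hz : ∀ t k m, θ k t ≠ 0 → m ≠ k → θ m t = 0 := fun t k m hk hmk => by
    by_contra h
    exact hmk (hθd m k t h hk)
  -- At each `t` at most one term is nonzero, so the sum needs no convergence in `E`; smoothness
  -- near `0` is tested by linear forms and comes from the weights, which depend on neither `E` nor
  -- `B`.
  refine ⟨fun t => ∑ᶠ k, (a k * θ k t) • (p k + (t - τ k) • q k), ?_, ?_, fun k => ?_⟩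
  · rw [curveSmoothOn_univ_iff_dual]
    intro l
    obtain ⟨C, hC⟩ := exists_abs_le_of_isVonNBounded hB l
    convert! hsum (fun k => l (p k)) (fun k => l (q k)) C (fun k => hC _ (hp k))
      (fun k => hC _ (hq k)) using 2 with t
    by_cases h : ∃ k, θ k t ≠ 0
    · obtain ⟨k, hk⟩ := h
      rw [finsum_eq_single _ k fun m hm => by simp [hz t k m hk hm],
        tsum_eq_single k fun m hm => by simp [hz t k m hk hm]]
      simp only [map_smul, map_add, smul_eq_mul]
      ring
    · push Not at h
      simp [h]
  · simp [hθ0]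
  · filter_upwards [hθ1 k] with t ht
    have hk : θ k t ≠ 0 := by simp [ht]
    rw [finsum_eq_single _ k fun m hm => by simp [hz t k m hk hm], ht, mul_one]

end SpecialCurve

/-! ### Finite differences and Kemperman's identity. -/

section Differences

/-- A sum over all subsets weighted by signs vanishes if the summand ignores one element. -/
theorem sum_powerset_neg_one_pow_eq_zero {S : Finset ℕ} {r : ℕ} (hr : r ∈ S) (G : Finset ℕ → ℝ)
    (hG : ∀ A, r ∉ A → G (insert r A) = G A) :
    ∑ A ∈ S.powerset, (-1) ^ A.card * G A = 0 := by
  rw [← Finset.insert_erase hr, Finset.sum_powerset_insert (Finset.notMem_erase r S),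
    ← Finset.sum_add_distrib]
  refine Finset.sum_eq_zero fun A hA => ?_
  have hrA : r ∉ A := fun h => Finset.notMem_erase r S (Finset.mem_powerset.1 hA h)
  rw [hG A hrA, Finset.card_insert_of_notMem hrA]
  ring

/-- Mixed differences are combinations of differences with equal steps (Kemperman). -/
theorem sum_powerset_eq_sum_differences {V : Type*} [AddCommGroup V] [Module ℝ V] (f : V → ℝ)
    (x : V) (d : ℕ → V) (N : ℕ) :
    ∑ A ∈ (Finset.range N).powerset, (-1 : ℝ) ^ A.card * ∑ k ∈ Finset.range (N + 1),
      (-1 : ℝ) ^ k * N.choose k * f (x + ∑ r ∈ A, (1 - k / (r + 1) : ℝ) • d r) =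
    ∑ A ∈ (Finset.range N).powerset, (-1 : ℝ) ^ A.card * f (x + ∑ r ∈ A, d r) := by
  simp only [Finset.mul_sum]
  rw [Finset.sum_comm, Finset.sum_range_succ']
  -- After exchanging the sums, the term of index `k + 1` ignores whether `k ∈ A`, since the factor
  -- `1 - (k + 1) / (r + 1)` vanishes at `r = k`. Only the index `0` survives.
  have h0 : ∀ k ∈ Finset.range N, ∑ A ∈ (Finset.range N).powerset, (-1 : ℝ) ^ A.card *
      ((-1 : ℝ) ^ (k + 1) * N.choose (k + 1) *
        f (x + ∑ r ∈ A, (1 - (k + 1 : ℕ) / (r + 1) : ℝ) • d r)) = 0 := by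
    intro k hk
    refine sum_powerset_neg_one_pow_eq_zero hk _ fun A hA => ?_
    rw [Finset.sum_insert hA]
    have : (1 - ((k + 1 : ℕ) : ℝ) / (k + 1) : ℝ) = 0 := by
      push_cast
      rw [div_self (by positivity), sub_self]
    rw [this, zero_smul, zero_add]
  rw [Finset.sum_eq_zero h0]
  simp

/-- Differences are controlled by derivatives. -/
theorem abs_fwdDiff_sub_le {σ : ℝ} (hσ : 0 < σ) (n : ℕ) {g : ℝ → ℝ} (hg : ContDiff ℝ ∞ g)
    {t A δ : ℝ} (h : ∀ x ∈ Icc t (t + n * σ), |iteratedDeriv n g x - A| ≤ δ) :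
    |(fwdDiff σ)^[n] g t - σ ^ n * A| ≤ δ * σ ^ n := by
  induction n generalizing g A δ with
  | zero => simpa using h t (by simp)
  | succ n ih =>
    have hgs : ContDiff ℝ ∞ (fun x => g (x + σ)) := hg.comp (contDiff_id.add contDiff_const)
    have hn : ∀ {f : ℝ → ℝ}, ContDiff ℝ ∞ f → ContDiff ℝ n f :=
      fun hf => hf.of_le (by exact_mod_cast le_top)
    have hd : ∀ x, iteratedDeriv n (fwdDiff σ g) x =
        iteratedDeriv n g (x + σ) - iteratedDeriv n g x := fun x => by
      change iteratedDeriv n ((fun x => g (x + σ)) - g) x = _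
      rw [iteratedDeriv_sub (hn hgs).contDiffAt (hn hg).contDiffAt, iteratedDeriv_comp_add_const]
    -- By the mean value inequality one forward difference trades one derivative for a factor `σ`,
    -- in the target `A` and in the error `δ` alike.
    have key := ih (g := fwdDiff σ g) (hgs.sub hg) (A := σ * A) (δ := δ * σ) fun x hx => by
      rw [hd]
      have hder : ∀ y ∈ Icc x (x + σ), HasDerivWithinAt (fun z => iteratedDeriv n g z - z * A)
          (iteratedDeriv (n + 1) g y - A) (Icc x (x + σ)) y := fun y _ => by
        have h1 : HasDerivAt (iteratedDeriv n g) (iteratedDeriv (n + 1) g y) y := by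
          rw [iteratedDeriv_succ]
          exact ((hg.differentiable_iteratedDeriv n (by exact_mod_cast WithTop.coe_lt_top _)) y
            ).hasDerivAt
        have h2 := h1.sub ((hasDerivAt_id y).mul_const A)
        rw [one_mul] at h2
        exact h2.hasDerivWithinAt
      have h3 := (convex_Icc x (x + σ)).norm_image_sub_le_of_norm_hasDerivWithin_le hder
        (fun y hy => h y ⟨hx.1.trans hy.1, hy.2.trans (by push_cast; linarith [hx.2])⟩)
        (left_mem_Icc.2 (by linarith)) (right_mem_Icc.2 (by linarith))
      simp only [Real.norm_eq_abs, add_sub_cancel_left, abs_of_pos hσ] at h3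
      calc |iteratedDeriv n g (x + σ) - iteratedDeriv n g x - σ * A|
          = |iteratedDeriv n g (x + σ) - (x + σ) * A - (iteratedDeriv n g x - x * A)| := by ring_nf
        _ ≤ δ * σ := h3
    rw [Function.iterate_succ_apply]
    calc |(fwdDiff σ)^[n] (fwdDiff σ g) t - σ ^ (n + 1) * A|
        = |(fwdDiff σ)^[n] (fwdDiff σ g) t - σ ^ n * (σ * A)| := by ring_nf
      _ ≤ δ * σ * σ ^ n := key
      _ = δ * σ ^ (n + 1) := by ring

end Differences

/-! ### Limits of smooth functions with bounded derivatives. -/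

section Limit

theorem hasDerivAt_of_abs_sub_le {g : ℝ → ℝ} {t D C r : ℝ} (hr : 0 < r)
    (h : ∀ s, |s| < r → |g (t + s) - g t - s * D| ≤ C * s ^ 2) : HasDerivAt g D t := by
  rw [hasDerivAt_iff_isLittleO_nhds_zero]
  have h1 : (fun s : ℝ => g (t + s) - g t - s • D) =O[𝓝 0] fun s => s ^ 2 := by
    refine Asymptotics.IsBigO.of_bound C ?_
    filter_upwards [Metric.ball_mem_nhds (0 : ℝ) hr] with s hs
    rw [Real.norm_eq_abs, Real.norm_eq_abs, abs_of_nonneg (sq_nonneg s), smul_eq_mul]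
    exact h s (by simpa using hs)
  exact h1.trans_isLittleO (by simpa using Asymptotics.isLittleO_pow_pow (𝕜 := ℝ) one_lt_two)

/-- Pointwise limits of smooth functions with locally bounded second derivatives can be
differentiated. -/
theorem tendsto_deriv_of_bounded {φ : ℕ → ℝ → ℝ} {φ₀ : ℝ → ℝ} (hφ : ∀ m, ContDiff ℝ ∞ (φ m))
    (hlim : ∀ t, Tendsto (fun m => φ m t) atTop (𝓝 (φ₀ t))) {t₀ r C : ℝ} (hr : 0 < r)
    (hb : ∀ᶠ m in atTop, ∀ t, |t - t₀| < r → |deriv (deriv (φ m)) t| ≤ C) :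
    HasDerivAt φ₀ (deriv φ₀ t₀) t₀ ∧
      Tendsto (fun m => deriv (φ m) t₀) atTop (𝓝 (deriv φ₀ t₀)) := by
  have hC : 0 ≤ C := by
    obtain ⟨m, hm⟩ := hb.exists
    exact (abs_nonneg _).trans (hm t₀ (by simpa using hr))
  have htay : ∀ᶠ m in atTop, ∀ s, |s| < r →
      |φ m (t₀ + s) - φ m t₀ - s * deriv (φ m) t₀| ≤ C * s ^ 2 := by
    filter_upwards [hb] with m hm s hs
    refine abs_taylor_le isOpen_univ (hφ m).contDiffOn (δ := |s|) (subset_univ _) hC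
      (fun x hx => hm x ?_) le_rfl
    refine lt_of_le_of_lt ?_ hs
    rw [abs_le]
    constructor <;> linarith [hx.1, hx.2]
  -- The derivatives are compared with difference quotients of one fixed step `s`: these converge in
  -- `m`, and the error is at most `C * s` uniformly in `m`.
  have hcau : CauchySeq fun m => deriv (φ m) t₀ := by
    refine Metric.cauchySeq_iff'.2 fun ε hε => ?_
    obtain ⟨s, hs0, hsr, hsε⟩ : ∃ s, 0 < s ∧ s < r ∧ C * s < ε / 4 := by
      refine ⟨min (r / 2) (ε / (8 * (C + 1))), by positivity,
        (min_le_left _ _).trans_lt (half_lt_self hr), ?_⟩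
      calc C * min (r / 2) (ε / (8 * (C + 1))) ≤ C * (ε / (8 * (C + 1))) := by
            gcongr
            exact min_le_right _ _
        _ ≤ (C + 1) * (ε / (8 * (C + 1))) := by gcongr; linarith
        _ = ε / 8 := by field_simp
        _ < ε / 4 := by linarith
    have hq : Tendsto (fun m => (φ m (t₀ + s) - φ m t₀) / s) atTop
        (𝓝 ((φ₀ (t₀ + s) - φ₀ t₀) / s)) := ((hlim _).sub (hlim _)).div_const s
    have hev := htay.and (hq.eventually (Metric.ball_mem_nhds _ (show 0 < ε / 4 by positivity)))
    obtain ⟨N, hN⟩ := eventually_atTop.1 hev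
    have hmain : ∀ m ≥ N, |deriv (φ m) t₀ - (φ₀ (t₀ + s) - φ₀ t₀) / s| < ε / 2 := by
      intro m hm
      have h1 := (hN m hm).1 s (by rwa [abs_of_pos hs0])
      have h2 : |(φ m (t₀ + s) - φ m t₀) / s - (φ₀ (t₀ + s) - φ₀ t₀) / s| < ε / 4 := by
        simpa [Real.dist_eq] using (hN m hm).2
      have h3 : |(φ m (t₀ + s) - φ m t₀) / s - deriv (φ m) t₀| ≤ C * s := by
        have : (φ m (t₀ + s) - φ m t₀) / s - deriv (φ m) t₀ =
            (φ m (t₀ + s) - φ m t₀ - s * deriv (φ m) t₀) / s := by field_simp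
        rw [this, abs_div, abs_of_pos hs0, div_le_iff₀ hs0]
        linarith
      rw [abs_lt] at h2 ⊢
      rw [abs_le] at h3
      constructor <;> linarith [h2.1, h2.2, h3.1, h3.2]
    refine ⟨N, fun m hm => ?_⟩
    have h1 := hmain m hm
    have h2 := hmain N le_rfl
    rw [Real.dist_eq]
    rw [abs_lt] at h1 h2 ⊢
    constructor <;> linarith [h1.1, h1.2, h2.1, h2.2]
  obtain ⟨D, hD⟩ := cauchySeq_tendsto_of_complete hcau
  have hder : HasDerivAt φ₀ D t₀ := by
    refine hasDerivAt_of_abs_sub_le (C := C) hr fun s hs => ?_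
    have h1 : Tendsto (fun m => |φ m (t₀ + s) - φ m t₀ - s * deriv (φ m) t₀|) atTop
        (𝓝 |φ₀ (t₀ + s) - φ₀ t₀ - s * D|) :=
      (((hlim _).sub (hlim _)).sub (hD.const_mul s)).abs
    exact le_of_tendsto h1 (htay.mono fun m hm => hm s hs)
  rw [hder.deriv]
  exact ⟨hder, hD⟩

/-- Pointwise limits of smooth functions with locally bounded derivatives are smooth. -/
theorem contDiff_of_tendsto_of_bounded {φ : ℕ → ℝ → ℝ} {φ₀ : ℝ → ℝ}
    (hφ : ∀ m, ContDiff ℝ ∞ (φ m))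
    (hlim : ∀ t, Tendsto (fun m => φ m t) atTop (𝓝 (φ₀ t)))
    (hb : ∀ (n : ℕ) (t₀ : ℝ), ∃ r > 0, ∃ C, ∀ᶠ m in atTop, ∀ t, |t - t₀| < r →
      |iteratedDeriv n (φ m) t| ≤ C) : ContDiff ℝ ∞ φ₀ := by
  rw [contDiff_infty]
  intro n
  have main : ∀ t, HasDerivAt φ₀ (deriv φ₀ t) t ∧
      Tendsto (fun m => deriv (φ m) t) atTop (𝓝 (deriv φ₀ t)) := fun t => by
    obtain ⟨r, hr, C, hC⟩ := hb 2 t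
    exact tendsto_deriv_of_bounded hφ hlim hr (by simpa [iteratedDeriv_succ] using hC)
  induction n generalizing φ φ₀ with
  | zero =>
    rw [Nat.cast_zero, contDiff_zero]
    exact continuous_iff_continuousAt.2 fun t => (main t).1.continuousAt
  | succ n ih =>
    rw [Nat.cast_succ, contDiff_succ_iff_deriv]
    have hφ' : ∀ m, ContDiff ℝ ∞ (deriv (φ m)) := fun m => (contDiff_infty_iff_deriv.1 (hφ m)).2
    have hb' : ∀ (n : ℕ) (t₀ : ℝ), ∃ r > 0, ∃ C, ∀ᶠ m in atTop, ∀ t, |t - t₀| < r →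
        |iteratedDeriv n (deriv (φ m)) t| ≤ C := fun n t₀ => by
      simpa only [iteratedDeriv_succ'] using hb (n + 1) t₀
    refine ⟨fun t => (main t).1.differentiableAt, by simp, ih hφ' (fun t => (main t).2) hb'
      fun t => ?_⟩
    obtain ⟨r, hr, C, hC⟩ := hb' 2 t
    exact tendsto_deriv_of_bounded hφ' (fun t => (main t).2) hr
      (by simpa [iteratedDeriv_succ] using hC)

end Limit

/-! ### Functions on the plane that are smooth along curves: directional bounds. -/

section Planar

/-- A function on the plane that is smooth along smooth curves. -/
def PlanarSmooth (h : ℝ → ℝ → ℝ) : Prop :=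
  ∀ a b : ℝ → ℝ, ContDiff ℝ ∞ a → ContDiff ℝ ∞ b → ContDiff ℝ ∞ fun t => h (a t) (b t)

variable {h : ℝ → ℝ → ℝ}

/-- Fast converging sequences of points in the plane are met by smooth curves in given
directions. -/
theorem exists_planar_curves : ∃ a τ : ℕ → ℝ, (∀ k, 0 < a k) ∧ Tendsto τ atTop (𝓝 0) ∧
    ∀ (x v : ℝ) (X : ℕ → ℝ), (∀ k, |X k - x| ≤ a k) → ∃ c : ℝ → ℝ, ContDiff ℝ ∞ c ∧ c 0 = x ∧
      ∀ k, ∀ᶠ t in 𝓝 (τ k), c t = X k + (a k * (t - τ k)) * v := by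
  obtain ⟨a, τ, ha, hτ, hc⟩ := exists_special_curve
  refine ⟨a, τ, ha, hτ, fun x v X hX => ?_⟩
  obtain ⟨c, hc, hc0, hcτ⟩ := hc (E := ℝ) (Metric.closedBall 0 (max 1 |v|))
    (NormedSpace.isVonNBounded_closedBall ℝ ℝ _) (fun k => (X k - x) / a k) (fun _ => v)
    (fun k => by
      rw [mem_closedBall_zero_iff, Real.norm_eq_abs, abs_div, abs_of_pos (ha k)]
      exact ((div_le_one (ha k)).2 (hX k)).trans (le_max_left _ _))
    (fun k => by
      rw [mem_closedBall_zero_iff, Real.norm_eq_abs]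
      exact le_max_right _ _)
  refine ⟨fun t => x + c t, contDiff_const.add ?_, by simp [hc0], fun k => ?_⟩
  · rwa [curveSmoothOn_real_iff isOpen_univ, contDiffOn_univ] at hc
  · filter_upwards [hcτ k] with t ht
    have := (ha k).ne'
    rw [ht, smul_eq_mul, smul_eq_mul]
    field_simp
    ring

theorem PlanarSmooth.line (hh : PlanarSmooth h) (x y v w : ℝ) :
    ContDiff ℝ ∞ fun t => h (x + t * v) (y + t * w) :=
  hh _ _ (contDiff_const.add (contDiff_id.mul contDiff_const))
    (contDiff_const.add (contDiff_id.mul contDiff_const))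

/-- Directional derivatives of all orders are locally bounded. -/
theorem PlanarSmooth.exists_directional_bound (hh : PlanarSmooth h) (n : ℕ) (v w x y : ℝ) :
    ∃ r > 0, ∃ C, ∀ x' y', |x' - x| ≤ r → |y' - y| ≤ r →
      |iteratedDeriv n (fun t => h (x' + t * v) (y' + t * w)) 0| ≤ C := by
  by_contra! hcon
  obtain ⟨a, τ, ha, hτ, hc⟩ := exists_planar_curves
  -- A smooth curve meets these bad points near `τ k` with velocity `a k • (v, w)`. The `n`-th
  -- derivative of `h` along it gains the factor `a k ^ n`, so it is at least `k` at `τ k → 0`,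
  -- against continuity.
  choose X Y hX hY hXY using fun k : ℕ => hcon (a k) (ha k) (k / a k ^ n)
  obtain ⟨c, hcs, hc0, hcτ⟩ := hc x v X hX
  obtain ⟨d, hds, hd0, hdτ⟩ := hc y w Y hY
  have hg := hh c d hcs hds
  have hcont : Tendsto (fun k => |iteratedDeriv n (fun t => h (c t) (d t)) (τ k)|) atTop
      (𝓝 |iteratedDeriv n (fun t => h (c t) (d t)) 0|) :=
    (((hg.continuous_iteratedDeriv n (by exact_mod_cast le_top)).tendsto 0).comp hτ).abs
  have heq : ∀ k, iteratedDeriv n (fun t => h (c t) (d t)) (τ k) =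
      a k ^ n * iteratedDeriv n (fun t => h (X k + t * v) (Y k + t * w)) 0 := fun k => by
    have h1 : (fun t => h (c t) (d t)) =ᶠ[𝓝 (τ k)] fun t =>
        (fun s => (fun u => h (X k + u * v) (Y k + u * w)) (a k * s)) (t - τ k) := by
      filter_upwards [hcτ k, hdτ k] with t h1 h2
      rw [h1, h2]
    rw [h1.iteratedDeriv_eq, iteratedDeriv_comp_sub_const n
      (fun s => (fun u => h (X k + u * v) (Y k + u * w)) (a k * s)),
      iteratedDeriv_comp_const_mul ((hh.line _ _ _ _).of_le (by exact_mod_cast le_top))]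
    simp
  have hge : ∀ k : ℕ, (k : ℝ) ≤ |iteratedDeriv n (fun t => h (c t) (d t)) (τ k)| := fun k => by
    rw [heq, abs_mul, abs_of_pos (pow_pos (ha k) n)]
    have := (hXY k).le
    rwa [div_le_iff₀ (pow_pos (ha k) n), mul_comm] at this
  exact not_tendsto_nhds_of_tendsto_atTop (tendsto_atTop_mono hge tendsto_natCast_atTop_atTop) _
    hcont

/-- Differences with equal steps are locally controlled by the step. -/
theorem PlanarSmooth.exists_difference_bound (hh : PlanarSmooth h) (N : ℕ) (v w x y : ℝ) :
    ∃ r > 0, ∃ C, ∀ x' y' σ, |x' - x| ≤ r → |y' - y| ≤ r → 0 < σ → σ ≤ r →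
      |∑ k ∈ Finset.range (N + 1), (-1 : ℝ) ^ k * N.choose k *
        h (x' + k * (σ * v)) (y' + k * (σ * w))| ≤ C * σ ^ N := by
  obtain ⟨r, hr, C, hC⟩ := hh.exists_directional_bound N v w x y
  have hM : 0 < 1 + N * (|v| + |w|) := by positivity
  -- Half of `r` is left for the base point and half for the segment of `N` steps.
  refine ⟨r / 2 / (1 + N * (|v| + |w|)), by positivity, C, fun x' y' σ hx hy hσ hσr => ?_⟩
  have hr2 : r / 2 / (1 + N * (|v| + |w|)) ≤ r / 2 := by
    refine div_le_self (by positivity) ?_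
    have : 0 ≤ N * (|v| + |w|) := by positivity
    linarith
  have hσN : N * σ * (|v| + |w|) ≤ r / 2 := by
    rw [le_div_iff₀ hM] at hσr
    nlinarith
  have key := abs_fwdDiff_sub_le hσ N (hh.line x' y' v w) (t := 0) (A := 0) (δ := C) fun s hs => by
    have h1 := iteratedDeriv_comp_const_add N (fun t => h (x' + t * v) (y' + t * w)) s
    have h2 : iteratedDeriv N (fun t => h (x' + t * v) (y' + t * w)) s =
        iteratedDeriv N (fun t => h (x' + s * v + t * v) (y' + s * w + t * w)) 0 := by
      rw [show (fun t => h (x' + s * v + t * v) (y' + s * w + t * w)) =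
        (fun z => (fun t => h (x' + t * v) (y' + t * w)) (s + z)) by
          funext z; simp only [add_mul, add_assoc], h1]
      simp only [add_zero]
    have hs0 : 0 ≤ s := hs.1
    have hsN : s ≤ N * σ := by simpa using hs.2
    have hv : |s * v| ≤ r / 2 := by
      rw [abs_mul, abs_of_nonneg hs0]
      nlinarith [abs_nonneg v, abs_nonneg w, mul_le_mul_of_nonneg_right hsN (abs_nonneg v),
        mul_nonneg (hs0.trans hsN) (abs_nonneg w)]
    have hw : |s * w| ≤ r / 2 := by
      rw [abs_mul, abs_of_nonneg hs0]
      nlinarith [abs_nonneg v, abs_nonneg w, mul_le_mul_of_nonneg_right hsN (abs_nonneg w),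
        mul_nonneg (hs0.trans hsN) (abs_nonneg v)]
    rw [sub_zero, h2]
    refine hC _ _ ?_ ?_
    · rw [show x' + s * v - x = (x' - x) + s * v by ring]
      exact (abs_add_le _ _).trans (by linarith)
    · rw [show y' + s * w - y = (y' - y) + s * w by ring]
      exact (abs_add_le _ _).trans (by linarith)
  rw [mul_zero, sub_zero, fwdDiff_iter_eq_sum_shift] at key
  have hsum : ∑ k ∈ Finset.range (N + 1), (-1 : ℝ) ^ k * N.choose k *
        h (x' + k * (σ * v)) (y' + k * (σ * w)) = (-1) ^ N * ∑ k ∈ Finset.range (N + 1),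
        ((-1 : ℤ) ^ (N - k) * (N.choose k : ℤ)) • h (x' + (0 + k • σ) * v) (y' + (0 + k • σ) * w) := by
    rw [Finset.mul_sum]
    refine Finset.sum_congr rfl fun k hk => ?_
    have hkN : k ≤ N := Nat.lt_succ_iff.1 (Finset.mem_range.1 hk)
    have h3 : (-1 : ℝ) ^ k = (-1) ^ N * (-1) ^ (N - k) := by
      obtain ⟨m, rfl⟩ := Nat.exists_eq_add_of_le hkN
      rw [Nat.add_sub_cancel_left, pow_add, mul_assoc, ← pow_add, ← two_mul, pow_mul]
      simp
    rw [h3, zsmul_eq_mul]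
    push_cast
    simp only [nsmul_eq_mul, zero_add, mul_assoc]
  rw [hsum, abs_mul, abs_pow, abs_neg, abs_one, one_pow, one_mul]
  exact key

end Planar

/-! ### Mixed differences and transversal derivatives. -/

section Planar

variable {h : ℝ → ℝ → ℝ}

/-- With `n` vertical steps and one horizontal step, a subset matters only through its number of
vertical steps and whether it contains the horizontal one. -/
theorem sum_powerset_mixed (h : ℝ → ℝ → ℝ) (n : ℕ) (x y σ : ℝ) (e : ℕ → ℝ × ℝ)
    (he : ∀ r < n, e r = (0, 1)) (hen : e n = (1, 0)) :
    ∑ A ∈ (Finset.range (n + 1)).powerset, (-1 : ℝ) ^ A.card *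
      (fun z : ℝ × ℝ => h z.1 z.2) ((x, y) + ∑ r ∈ A, σ • e r) =
    ∑ i ∈ Finset.range (n + 1), (-1 : ℝ) ^ i * n.choose i *
      (h x (y + i * σ) - h (x + σ) (y + i * σ)) := by
  have hsum : ∀ A ∈ (Finset.range n).powerset, ∑ r ∈ A, σ • e r = (0, A.card * σ) := by
    intro A hA
    rw [Finset.sum_congr rfl fun r hr => by
      rw [he r (Finset.mem_range.1 (Finset.mem_powerset.1 hA hr))], Finset.sum_const]
    simp
  rw [Finset.range_add_one, Finset.sum_powerset_insert Finset.notMem_range_self,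
    ← Finset.sum_add_distrib]
  have hG : ∀ A ∈ (Finset.range n).powerset, (-1 : ℝ) ^ A.card *
      (fun z : ℝ × ℝ => h z.1 z.2) ((x, y) + ∑ r ∈ A, σ • e r) + (-1 : ℝ) ^ (insert n A).card *
      (fun z : ℝ × ℝ => h z.1 z.2) ((x, y) + ∑ r ∈ insert n A, σ • e r) =
      (fun i : ℕ => (-1 : ℝ) ^ i * (h x (y + i * σ) - h (x + σ) (y + i * σ))) A.card := by
    intro A hA
    have hnA : n ∉ A := fun hn => Finset.notMem_range_self (Finset.mem_powerset.1 hA hn)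
    rw [Finset.card_insert_of_notMem hnA, Finset.sum_insert hnA, hsum A hA, hen]
    simp only [Prod.mk_add_mk, Prod.smul_mk, smul_eq_mul, mul_one, mul_zero, add_zero, zero_add]
    ring
  rw [Finset.sum_congr rfl hG, Finset.sum_powerset_apply_card
    (fun i : ℕ => (-1 : ℝ) ^ i * (h x (y + i * σ) - h (x + σ) (y + i * σ))), Finset.card_range,
    ← Finset.range_add_one]
  refine Finset.sum_congr rfl fun i _ => ?_
  rw [nsmul_eq_mul]
  ring

/-- Mixed differences are locally controlled by the step. -/
theorem PlanarSmooth.exists_mixed_bound (hh : PlanarSmooth h) (n : ℕ) (x y : ℝ) :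
    ∃ r > 0, ∃ C, ∀ x' y' σ, |x' - x| ≤ r → |y' - y| ≤ r → 0 < σ → σ ≤ r →
      |∑ i ∈ Finset.range (n + 1), (-1 : ℝ) ^ i * n.choose i *
        (h x' (y' + i * σ) - h (x' + σ) (y' + i * σ))| ≤ C * σ ^ (n + 1) := by
  set e : ℕ → ℝ × ℝ := fun r => if r < n then (0, 1) else (1, 0) with he
  -- In Kemperman's identity the `k`-th point belonging to `A` is the base point moved by `σ • b A +
  -- k • (σ • v A)`. The inner sum is thus an equal-step difference in the direction `v A`, already
  -- under control.
  set b : Finset ℕ → ℝ × ℝ := fun A => ∑ r ∈ A, e r with hb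
  set v : Finset ℕ → ℝ × ℝ := fun A => -∑ r ∈ A, (1 / (r + 1) : ℝ) • e r with hv
  choose ρ hρ C hC using fun A : Finset ℕ =>
    hh.exists_difference_bound (n + 1) (v A).1 (v A).2 x y
  set S := (Finset.range (n + 1)).powerset with hS
  have hev : ∀ᶠ r : ℝ in 𝓝[>] 0, ∀ A ∈ S, r ≤ ρ A ∧ r + r * |(b A).1| ≤ ρ A ∧
      r + r * |(b A).2| ≤ ρ A := by
    rw [Filter.eventually_all_finset]
    intro A _
    have hlim : ∀ M : ℝ, ∀ᶠ r : ℝ in 𝓝[>] 0, r + r * M ≤ ρ A := fun M => by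
      have h1 : Tendsto (fun r : ℝ => r + r * M) (𝓝 0) (𝓝 (0 + 0 * M)) :=
        tendsto_id.add (tendsto_id.mul_const M)
      rw [zero_mul, add_zero] at h1
      exact (h1.mono_left nhdsWithin_le_nhds).eventually_le_const (hρ A)
    filter_upwards [hlim 0, hlim |(b A).1|, hlim |(b A).2|] with r h0 h1 h2
    exact ⟨by simpa using h0, h1, h2⟩
  obtain ⟨r, hrS, hr⟩ := (hev.and self_mem_nhdsWithin).exists
  refine ⟨r, hr, ∑ A ∈ S, C A, fun x' y' σ hx hy hσ hσr => ?_⟩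
  rw [← sum_powerset_mixed h n x' y' σ e (fun r hr => by simp [he, hr]) (by simp [he]),
    ← sum_powerset_eq_sum_differences (fun z : ℝ × ℝ => h z.1 z.2) (x', y') (fun r => σ • e r),
    Finset.sum_mul]
  refine (Finset.abs_sum_le_sum_abs _ _).trans (Finset.sum_le_sum fun A hA => ?_)
  obtain ⟨h0, h1, h2⟩ := hrS A hA
  rw [abs_mul, abs_pow, abs_neg, abs_one, one_pow, one_mul]
  have key := hC A (x' + σ * (b A).1) (y' + σ * (b A).2) σ
    (by
      rw [show x' + σ * (b A).1 - x = (x' - x) + σ * (b A).1 by ring]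
      refine (abs_add_le _ _).trans (le_trans ?_ h1)
      rw [abs_mul, abs_of_pos hσ]
      gcongr)
    (by
      rw [show y' + σ * (b A).2 - y = (y' - y) + σ * (b A).2 by ring]
      refine (abs_add_le _ _).trans (le_trans ?_ h2)
      rw [abs_mul, abs_of_pos hσ]
      gcongr) hσ (hσr.trans h0)
  refine le_trans (le_of_eq (congrArg _ (Finset.sum_congr rfl fun k _ => ?_))) key
  have hpt : (x', y') + ∑ r ∈ A, (1 - k / (r + 1) : ℝ) • σ • e r =
      (x' + σ * (b A).1 + k * (σ * (v A).1), y' + σ * (b A).2 + k * (σ * (v A).2)) := by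
    have : ∑ r ∈ A, (1 - k / (r + 1) : ℝ) • σ • e r = σ • b A + (k : ℝ) • σ • v A := by
      rw [hb, hv, Finset.smul_sum, smul_neg, smul_neg, Finset.smul_sum, Finset.smul_sum,
        ← sub_eq_add_neg, ← Finset.sum_sub_distrib]
      refine Finset.sum_congr rfl fun r _ => ?_
      rw [smul_smul, smul_smul, smul_smul, ← sub_smul]
      congr 1
      ring
    rw [this]
    ext <;> simp [add_assoc]
  rw [hpt]

/-- The difference of two neighbouring vertical slices is small with all its derivatives. -/
theorem PlanarSmooth.exists_slice_bound (hh : PlanarSmooth h) (n : ℕ) (x y : ℝ) :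
    ∃ r > 0, ∃ C, ∀ t s, |t - y| ≤ r → 0 < s → s ≤ r →
      |iteratedDeriv n (fun u => h (x + s) u - h x u) t| ≤ C * s := by
  obtain ⟨r, hr, C, hC⟩ := hh.exists_mixed_bound n x y
  refine ⟨r, hr, C, fun t s ht hs hsr => ?_⟩
  set g : ℝ → ℝ := fun u => h (x + s) u - h x u with hg
  have hgs : ContDiff ℝ ∞ g := (hh _ _ contDiff_const contDiff_id).sub
    (hh _ _ contDiff_const contDiff_id)
  -- The horizontal step `s` is cut into `m + 1` pieces of the vertical step size `σ`, and the mixed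
  -- bounds add up to `(m + 1) * C * σ ^ (n + 1) = C * s * σ ^ n`. Division by `σ ^ n` as `m → ∞`
  -- will give the derivative.
  have hdiff : ∀ m : ℕ, |(fwdDiff (s / (m + 1)))^[n] g t| ≤ C * s * (s / (m + 1)) ^ n := by
    intro m
    set σ := s / (m + 1) with hσ
    have hσ0 : 0 < σ := by positivity
    have hσs : (m + 1) * σ = s := by
      rw [hσ]
      field_simp
    have htel : ∀ u, g u = -∑ l ∈ Finset.range (m + 1),
        (h (x + l * σ) u - h (x + l * σ + σ) u) := fun u => by
      have := Finset.sum_range_sub' (fun l : ℕ => h (x + l * σ) u) (m + 1)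
      push_cast at this
      rw [hσs, zero_mul, add_zero] at this
      simp only [add_mul, one_mul, ← add_assoc] at this
      rw [this, hg]
      ring
    have hsum : (fwdDiff σ)^[n] g t = -((-1) ^ n * ∑ l ∈ Finset.range (m + 1),
        ∑ i ∈ Finset.range (n + 1), (-1 : ℝ) ^ i * n.choose i *
          (h (x + l * σ) (t + i * σ) - h (x + l * σ + σ) (t + i * σ))) := by
      rw [fwdDiff_iter_eq_sum_shift, Finset.sum_comm, Finset.mul_sum, ← Finset.sum_neg_distrib]
      refine Finset.sum_congr rfl fun i hi => ?_
      have hin : i ≤ n := Nat.lt_succ_iff.1 (Finset.mem_range.1 hi)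
      have h3 : (-1 : ℝ) ^ i = (-1) ^ n * (-1) ^ (n - i) := by
        obtain ⟨m, rfl⟩ := Nat.exists_eq_add_of_le hin
        rw [Nat.add_sub_cancel_left, pow_add, mul_assoc, ← pow_add, ← two_mul, pow_mul]
        simp
      have h4 : (-1 : ℝ) ^ n * (-1) ^ n = 1 := by rw [← mul_pow]; simp
      rw [htel, ← Finset.mul_sum, h3, zsmul_eq_mul, nsmul_eq_mul]
      push_cast
      linear_combination (-1 : ℝ) ^ (n - i) * (n.choose i) * (∑ l ∈ Finset.range (m + 1),
        (h (x + l * σ) (t + i * σ) - h (x + l * σ + σ) (t + i * σ))) * h4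
    rw [hsum, abs_neg, abs_mul, abs_pow, abs_neg, abs_one, one_pow, one_mul]
    calc _ ≤ ∑ l ∈ Finset.range (m + 1), C * σ ^ (n + 1) := by
          refine (Finset.abs_sum_le_sum_abs _ _).trans (Finset.sum_le_sum fun l hl => ?_)
          have hlm : (l : ℝ) ≤ m := by
            exact_mod_cast Nat.lt_succ_iff.1 (Finset.mem_range.1 hl)
          refine hC _ _ _ ?_ ht hσ0 ?_
          · rw [add_sub_cancel_left, abs_of_nonneg (by positivity)]
            nlinarith
          · nlinarith [Nat.cast_nonneg (α := ℝ) m]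
      _ = C * ((m + 1) * σ) * σ ^ n := by
          rw [Finset.sum_const, Finset.card_range, nsmul_eq_mul]
          push_cast
          ring
      _ = C * s * σ ^ n := by rw [hσs]
  refine le_of_forall_pos_le_add fun ε hε => ?_
  set A := iteratedDeriv n g t with hA
  obtain ⟨δ, hδ, hδA⟩ := Metric.continuousAt_iff.1
    ((hgs.continuous_iteratedDeriv n (by exact_mod_cast le_top)).continuousAt (x := t)) ε hε
  have hlim : Tendsto (fun m : ℕ => n * (s * (1 / ((m : ℝ) + 1)))) atTop (𝓝 (n * (s * 0))) :=
    (tendsto_one_div_add_atTop_nhds_zero_nat.const_mul s).const_mul _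
  rw [mul_zero, mul_zero] at hlim
  obtain ⟨m, hm⟩ := (hlim.eventually_lt_const hδ).exists
  rw [← mul_div_assoc s, mul_one] at hm
  have hσ0 : 0 < s / ((m : ℝ) + 1) := by positivity
  have h1 := abs_fwdDiff_sub_le hσ0 n hgs (t := t) (A := A) (δ := ε) fun z hz => by
    refine (hδA ?_).le
    rw [Real.dist_eq, abs_of_nonneg (by linarith [hz.1])]
    linarith [hz.2]
  have h2 := hdiff m
  have h3 : (s / ((m : ℝ) + 1)) ^ n * |A| ≤ (s / ((m : ℝ) + 1)) ^ n * (C * s + ε) := by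
    rw [← abs_of_pos (pow_pos hσ0 n), ← abs_mul, abs_of_pos (pow_pos hσ0 n)]
    rw [abs_le] at h1 h2 ⊢
    constructor <;> nlinarith [h1.1, h1.2, h2.1, h2.2]
  exact le_of_mul_le_mul_left h3 (pow_pos hσ0 n)

/-- The transversal derivative along a vertical slice is smooth. -/
theorem PlanarSmooth.contDiff_deriv (hh : PlanarSmooth h) :
    ContDiff ℝ ∞ fun t => deriv (fun s => h s t) 0 := by
  set η : ℕ → ℝ := fun m => 1 / ((m : ℝ) + 1) with hη
  have hη0 : ∀ m, 0 < η m := fun m => by positivity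
  have hηt : Tendsto η atTop (𝓝 0) := tendsto_one_div_add_atTop_nhds_zero_nat
  have hs : ∀ s, ContDiff ℝ ∞ fun t => h s t := fun s => hh _ _ contDiff_const contDiff_id
  -- Difference quotients in `s` with step `η m` converge pointwise, and the slice bound divided by
  -- `η m` bounds their `t`-derivatives of each order.
  refine contDiff_of_tendsto_of_bounded
    (φ := fun m t => (η m)⁻¹ * (h (0 + η m) t - h 0 t))
    (fun m => contDiff_const.mul ((hs _).sub (hs _))) (fun t => ?_) fun n t₀ => ?_
  · have hd : HasDerivAt (fun s => h s t) (deriv (fun s => h s t) 0) 0 :=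
      (((hh _ _ contDiff_id contDiff_const).differentiable (by simp)) 0).hasDerivAt
    exact (hasDerivAt_iff_tendsto_slope_tvs.1 hd).comp (tendsto_nhdsWithin_iff.2
      ⟨hηt, Eventually.of_forall fun m => (hη0 m).ne'⟩)
  · obtain ⟨r, hr, C, hC⟩ := hh.exists_slice_bound n 0 t₀
    refine ⟨r, hr, C, ?_⟩
    filter_upwards [hηt.eventually_le_const hr] with m hm t ht
    rw [iteratedDeriv_const_mul _ (((hs _).sub (hs _)).of_le (by exact_mod_cast le_top)).contDiffAt,
      abs_mul, abs_inv, abs_of_pos (hη0 m), inv_mul_le_iff₀ (hη0 m), mul_comm]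
    exact hC t (η m) ht.le (hη0 m) hm

/-- The derivative along the diagonal. -/
theorem PlanarSmooth.deriv_diag (hh : PlanarSmooth h) :
    deriv (fun t => h t t) 0 = deriv (fun s => h s 0) 0 + deriv (fun t => h 0 t) 0 := by
  have hd : ∀ {g : ℝ → ℝ}, ContDiff ℝ ∞ g → HasDerivAt g (deriv g 0) 0 := fun hg =>
    ((hg.differentiable (by simp)) 0).hasDerivAt
  have h1 := hd (hh _ _ contDiff_id contDiff_id)
  have h2 := hd (hh _ _ contDiff_id (contDiff_const (c := (0 : ℝ))))
  have h3 := hd (hh _ _ (contDiff_const (c := (0 : ℝ))) contDiff_id)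
  have h4 := (h1.sub h2).sub h3
  -- For `n = 1` this says `h s s - h s 0 - h 0 s + h 0 0 = O(s ^ 2)`. A one-sided limit suffices,
  -- since the three derivatives are known to exist.
  obtain ⟨r, hr, C, hC⟩ := hh.exists_mixed_bound 1 0 0
  have h5 := (hasDerivAt_iff_tendsto_slope_tvs.1 h4).mono_left
    (nhdsWithin_mono (0 : ℝ) (fun s (hs : 0 < s) => hs.ne') : 𝓝[>] (0 : ℝ) ≤ 𝓝[≠] 0)
  have h6 : Tendsto (fun s : ℝ => C * s) (𝓝[>] 0) (𝓝 0) := by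
    have : Tendsto (fun s : ℝ => C * s) (𝓝 0) (𝓝 (C * 0)) := tendsto_id.const_mul C
    rw [mul_zero] at this
    exact this.mono_left nhdsWithin_le_nhds
  have h7 := tendsto_nhds_unique h5 (squeeze_zero_norm' (by
    have : ∀ᶠ s : ℝ in 𝓝[>] 0, s ≤ r :=
      (tendsto_id.mono_left nhdsWithin_le_nhds).eventually_le_const hr
    filter_upwards [this, self_mem_nhdsWithin] with s hs hs0
    have hs0 : 0 < s := hs0
    have h8 := hC 0 0 s (by simpa using hr.le) (by simpa using hr.le) hs0 hs
    simp only [Finset.sum_range_succ, Finset.sum_range_zero] at h8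
    norm_num at h8
    simp only [Pi.sub_apply, id, zero_add, smul_eq_mul, norm_mul, norm_inv, Real.norm_eq_abs,
      abs_of_pos hs0]
    rw [inv_mul_le_iff₀ hs0]
    refine le_trans (le_of_eq ?_) (h8.trans_eq (by ring))
    congr 1
    ring) h6)
  simp only [id] at h7
  linarith

/-- Reparametrising by such a function makes a germ at `0` global without changing it. -/
theorem exists_cutoff {r : ℝ} (hr : 0 < r) :
    ∃ κ : ℝ → ℝ, ContDiff ℝ ∞ κ ∧ (∀ t, |κ t| < r) ∧ ∀ᶠ t in 𝓝 0, κ t = t := by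
  let b : ContDiffBump (0 : ℝ) := ⟨r / 2, r, by positivity, by linarith⟩
  refine ⟨fun t => t * b t, contDiff_id.mul b.contDiff, fun t => ?_, ?_⟩
  · by_cases ht : |t| < r
    · rw [abs_mul, abs_of_nonneg b.nonneg]
      exact lt_of_le_of_lt (mul_le_of_le_one_right (abs_nonneg t) b.le_one) ht
    · change |t * b t| < r
      rw [b.zero_of_le_dist (by simpa [Real.dist_eq] using not_lt.1 ht)]
      simpa using hr
  · filter_upwards [b.eventuallyEq_one] with t ht
    rw [ht]
    simp

end Planar

/-! ### Hadamard's lemma in one variable. -/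

section Slope

open MeasureTheory in
-- The weight `u ^ n` makes this family of integrals closed under differentiation, so that
-- smoothness follows by induction on the order.
theorem hasDerivAt_integral_pow_mul {g : ℝ → ℝ} (hg : ContDiff ℝ ∞ g) (n : ℕ) (t : ℝ) :
    HasDerivAt (fun t => ∫ u in (0 : ℝ)..1, u ^ n * g (u * t))
      (∫ u in (0 : ℝ)..1, u ^ (n + 1) * deriv g (u * t)) t := by
  have hg' : Continuous (deriv g) := (contDiff_infty_iff_deriv.1 hg).2.continuous
  have hc : Continuous fun z : ℝ × ℝ => z.1 ^ (n + 1) * deriv g (z.1 * z.2) := by fun_prop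
  obtain ⟨C, hC⟩ := ((isCompact_Icc (a := (0 : ℝ)) (b := 1)).prod
    (isCompact_closedBall t 1)).exists_bound_of_continuousOn hc.continuousOn
  have hgc := hg.continuous
  refine (intervalIntegral.hasDerivAt_integral_of_dominated_loc_of_deriv_le (μ := volume)
    (F := fun t u => u ^ n * g (u * t)) (F' := fun t u => u ^ (n + 1) * deriv g (u * t))
    (bound := fun _ => C) (Metric.ball_mem_nhds t one_pos) ?_ ?_ ?_ ?_ ?_ ?_).2
  · exact Eventually.of_forall fun x =>
      (by fun_prop : Continuous fun u : ℝ => u ^ n * g (u * x)).aestronglyMeasurable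
  · exact (by fun_prop : Continuous fun u : ℝ => u ^ n * g (u * t)).intervalIntegrable _ _
  · exact (by fun_prop :
      Continuous fun u : ℝ => u ^ (n + 1) * deriv g (u * t)).aestronglyMeasurable
  · refine Eventually.of_forall fun u hu x hx => hC (u, x) ⟨?_, Metric.ball_subset_closedBall hx⟩
    rw [uIoc_of_le zero_le_one] at hu
    exact ⟨hu.1.le, hu.2⟩
  · exact continuous_const.intervalIntegrable _ _
  · refine Eventually.of_forall fun u _ x _ => ?_
    have h1 : HasDerivAt g (deriv g (u * x)) (u * x) :=
      ((hg.differentiable (by simp)) _).hasDerivAt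
    have h2 := (h1.comp x ((hasDerivAt_id x).const_mul u)).const_mul (u ^ n)
    refine h2.congr_deriv ?_
    simp only [mul_one]
    ring

theorem contDiff_integral_pow_mul {g : ℝ → ℝ} (hg : ContDiff ℝ ∞ g) (n : ℕ) :
    ContDiff ℝ ∞ fun t => ∫ u in (0 : ℝ)..1, u ^ n * g (u * t) := by
  rw [contDiff_infty]
  intro N
  induction N generalizing n g with
  | zero =>
    rw [Nat.cast_zero, contDiff_zero]
    exact continuous_iff_continuousAt.2 fun t => (hasDerivAt_integral_pow_mul hg n t).continuousAt
  | succ N ih =>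
    rw [Nat.cast_succ, contDiff_succ_iff_deriv]
    refine ⟨fun t => (hasDerivAt_integral_pow_mul hg n t).differentiableAt, by simp, ?_⟩
    rw [funext fun t => (hasDerivAt_integral_pow_mul hg n t).deriv]
    exact ih (contDiff_infty_iff_deriv.1 hg).2 (n + 1)

/-- The slope is the integral of `deriv g (u * t)` over `u` in `[0, 1]`. -/
theorem contDiff_dslope_zero {g : ℝ → ℝ} (hg : ContDiff ℝ ∞ g) : ContDiff ℝ ∞ (dslope g 0) := by
  have hg' := (contDiff_infty_iff_deriv.1 hg).2
  convert! contDiff_integral_pow_mul hg' 0 using 1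
  funext t
  simp only [pow_zero, one_mul]
  rcases eq_or_ne t 0 with rfl | ht
  · simp
  · rw [dslope_of_ne _ ht, slope_def_field, sub_zero, intervalIntegral.integral_comp_mul_right _ ht,
      zero_mul, one_mul, intervalIntegral.integral_deriv_eq_sub
        (fun x _ => hg.differentiable (by simp) x) (hg'.continuous.intervalIntegrable _ _),
      smul_eq_mul, div_eq_inv_mul]

end Slope

/-! ### Differential calculus of maps that are smooth along curves. -/

section SmoothMaps

variable {E : Type*} [AddCommGroup E] [Module ℝ E] [TopologicalSpace E]

/-- A subset of `E` that is open in the `c^∞`-topology. -/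
def CInfOpen (U : Set E) : Prop :=
  ∀ (J : Set ℝ) (c : ℝ → E), IsOpen J → CurveSmoothOn J c → IsOpen (J ∩ c ⁻¹' U)

theorem _root_.IsOpen.cInfOpen {O : Set (CInf E)} (hO : IsOpen O) :
    CInfOpen {u : E | CInf.of u ∈ O} := hO

variable [ConvenientSpace E] {G : Type*} [AddCommGroup G] [Module ℝ G] [TopologicalSpace G]
  [ConvenientSpace G]

omit [ConvenientSpace E] in
theorem hasDerivAt_shift_iff [IsTopologicalAddGroup E] [ContinuousSMul ℝ E] {c : ℝ → E} {d : E}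
    {t : ℝ} : HasDerivAt (fun s => c (t + s)) d 0 ↔ HasDerivAt c d t := by
  simp only [hasDerivAt_iff_tendsto_slope_tvs, zero_add, add_zero]

theorem CurveSmoothOn.hasDerivAt {J : Set ℝ} {c : ℝ → E} (h : CurveSmoothOn J c) {t : ℝ}
    (ht : t ∈ J) : HasDerivAt c (_root_.deriv c t) t :=
  (h 0 t ht).hasDerivAt_tvs

theorem CurveSmoothOn.comp_contDiffOn {J J' : Set ℝ} (hJ : IsOpen J) (hJ' : IsOpen J')
    {c : ℝ → E} (hc : CurveSmoothOn J c) {a : ℝ → ℝ} (ha : ContDiffOn ℝ ∞ a J')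
    (hm : MapsTo a J' J) : CurveSmoothOn J' (fun t => c (a t)) := by
  rw [curveSmoothOn_iff_dual hJ']
  exact fun l => ((curveSmoothOn_iff_dual hJ).1 hc l).comp ha hm

theorem curveSmoothOn_add_smul {J : Set ℝ} (hJ : IsOpen J) {c w : ℝ → E} {a : ℝ → ℝ}
    (hc : CurveSmoothOn J c) (ha : ContDiffOn ℝ ∞ a J) (hw : CurveSmoothOn J w) :
    CurveSmoothOn J (fun t => c t + a t • w t) := by
  rw [curveSmoothOn_iff_dual hJ] at hc hw ⊢
  intro l
  simp only [map_add, map_smul, smul_eq_mul]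
  exact (hc l).add (ha.mul (hw l))

theorem curveSmoothOn_line (u v : E) : CurveSmoothOn univ (fun t : ℝ => u + t • v) :=
  curveSmoothOn_add_smul isOpen_univ (curveSmoothOn_const _ u) contDiffOn_id
    (curveSmoothOn_const _ v)

/-- Germs of smooth curves are germs of global smooth curves. -/
theorem CurveSmoothOn.exists_global {J : Set ℝ} (hJ : IsOpen J) {c : ℝ → E}
    (hc : CurveSmoothOn J c) {t : ℝ} (ht : t ∈ J) :
    ∃ c' : ℝ → E, CurveSmoothOn univ c' ∧ ∀ᶠ s in 𝓝 0, c' s = c (t + s) := by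
  obtain ⟨r, hr, hrJ⟩ := Metric.isOpen_iff.1 hJ t ht
  obtain ⟨κ, hκ, hκr, hκ0⟩ := exists_cutoff hr
  refine ⟨fun s => c (t + κ s), hc.comp_contDiffOn hJ isOpen_univ
    (contDiff_const.add hκ).contDiffOn fun s _ => hrJ ?_, hκ0.mono fun s hs => by simp only [hs]⟩
  simpa [Real.dist_eq] using hκr s

/-- A two-parameter family of points of `E` that is smooth along smooth curves. -/
def PlanarSmoothFamily (Γ : ℝ → ℝ → E) : Prop :=
  ∀ a b : ℝ → ℝ, ContDiff ℝ ∞ a → ContDiff ℝ ∞ b → CurveSmoothOn univ fun t => Γ (a t) (b t)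

-- Openness of `U` is only known along curves. Parameters violating the claim and tending to `0`
-- fast enough would lie on a smooth curve in the plane, whose image under `Γ` would leave `U` at
-- times tending to `0`.
omit [ConvenientSpace E] in
theorem PlanarSmoothFamily.exists_forall_mem {Γ : ℝ → ℝ → E} (hΓ : PlanarSmoothFamily Γ)
    {U : Set E} (hU : CInfOpen U) (h0 : Γ 0 0 ∈ U) :
    ∃ r > 0, ∀ s t, |s| < r → |t| < r → Γ s t ∈ U := by
  by_contra! hcon
  obtain ⟨a, τ, ha, hτ, hc⟩ := exists_planar_curves
  choose X Y hX hY hXY using fun k : ℕ => hcon (a k) (ha k)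
  obtain ⟨c, hcs, hc0, hcτ⟩ := hc 0 0 X fun k => by simpa using (hX k).le
  obtain ⟨d, hds, hd0, hdτ⟩ := hc 0 0 Y fun k => by simpa using (hY k).le
  have hopen := hU _ _ isOpen_univ (hΓ c d hcs hds)
  rw [univ_inter] at hopen
  obtain ⟨k, hk⟩ := (hτ.eventually (hopen.mem_nhds (by simpa [hc0, hd0] using h0))).exists
  refine hXY k ?_
  have h1 := (hcτ k).self_of_nhds
  have h2 := (hdτ k).self_of_nhds
  simp only [mul_zero, add_zero] at h1 h2
  simpa [h1, h2] using hk

variable {U : Set E} {f : E → G}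

omit [ConvenientSpace E] [ConvenientSpace G] in
theorem PlanarSmoothFamily.exists_comp {Γ : ℝ → ℝ → E} (hΓ : PlanarSmoothFamily Γ)
    (hU : CInfOpen U) (hf : SmoothMapOn U f) (h0 : Γ 0 0 ∈ U) :
    ∃ κ : ℝ → ℝ, κ 0 = 0 ∧ (∀ᶠ t in 𝓝 0, κ t = t) ∧
      PlanarSmoothFamily fun s t => f (Γ (κ s) (κ t)) := by
  obtain ⟨r, hr, hrU⟩ := hΓ.exists_forall_mem hU h0
  obtain ⟨κ, hκ, hκr, hκ0⟩ := exists_cutoff hr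
  refine ⟨κ, hκ0.self_of_nhds, hκ0, fun a b ha hb => ?_⟩
  exact hf univ _ isOpen_univ (hΓ _ _ (hκ.comp ha) (hκ.comp hb))
    fun t _ => hrU _ _ (hκr _) (hκr _)

theorem PlanarSmoothFamily.dual {Γ : ℝ → ℝ → E} (hΓ : PlanarSmoothFamily Γ) (l : E →L[ℝ] ℝ) :
    PlanarSmooth fun s t => l (Γ s t) := fun a b ha hb =>
  curveSmoothOn_univ_iff_dual.1 (hΓ a b ha hb) l

theorem PlanarSmoothFamily.deriv_diag {Γ : ℝ → ℝ → E} (hΓ : PlanarSmoothFamily Γ) :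
    deriv (fun t => Γ t t) 0 = deriv (fun s => Γ s 0) 0 + deriv (fun t => Γ 0 t) 0 := by
  rw [SeparatingDual.eq_iff_forall_dual_eq (R := ℝ)]
  intro l
  have h1 := ((hΓ id id contDiff_id contDiff_id).hasDerivAt (mem_univ 0)).clm_comp_tvs l
  have h2 := ((hΓ id (fun _ => 0) contDiff_id contDiff_const).hasDerivAt
    (mem_univ 0)).clm_comp_tvs l
  have h3 := ((hΓ (fun _ => 0) id contDiff_const contDiff_id).hasDerivAt
    (mem_univ 0)).clm_comp_tvs l
  have := (hΓ.dual l).deriv_diag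
  simp only [id] at h1 h2 h3
  rw [h1.deriv, h2.deriv, h3.deriv] at this
  rw [map_add, this]

theorem PlanarSmoothFamily.curveSmoothOn_deriv {Γ : ℝ → ℝ → E} (hΓ : PlanarSmoothFamily Γ) :
    CurveSmoothOn univ fun t => deriv (fun s => Γ s t) 0 := by
  rw [curveSmoothOn_univ_iff_dual]
  intro l
  have h1 : ∀ t, l (deriv (fun s => Γ s t) 0) = deriv (fun s => l (Γ s t)) 0 := fun t =>
    (((hΓ id (fun _ => t) contDiff_id contDiff_const).hasDerivAt
      (mem_univ 0)).clm_comp_tvs l).deriv.symm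
  simp only [h1]
  exact (hΓ.dual l).contDiff_deriv

-- The common source of the chain rule and of additivity of the derivative: each comes from a
-- suitable choice of `Γ`.
omit [ConvenientSpace E] in
theorem PlanarSmoothFamily.hasDerivAt_comp_diag {Γ : ℝ → ℝ → E} (hΓ : PlanarSmoothFamily Γ)
    (hU : CInfOpen U) (hf : SmoothMapOn U f) (h0 : Γ 0 0 ∈ U) :
    HasDerivAt (fun t => f (Γ t t))
      (deriv (fun s => f (Γ s 0)) 0 + deriv (fun t => f (Γ 0 t)) 0) 0 := by
  obtain ⟨κ, hκ0, hκ, hH⟩ := hΓ.exists_comp hU hf h0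
  have h1 := hH.deriv_diag
  have h2 := (hH id id contDiff_id contDiff_id).hasDerivAt (mem_univ 0)
  simp only [id] at h2
  rw [h1, hκ0] at h2
  have e1 : (fun s => f (Γ s 0)) =ᶠ[𝓝 0] fun s => f (Γ (κ s) 0) := hκ.mono fun s hs => by simp only [hs]
  have e2 : (fun s => f (Γ 0 s)) =ᶠ[𝓝 0] fun s => f (Γ 0 (κ s)) := hκ.mono fun s hs => by simp only [hs]
  have e3 : (fun s => f (Γ s s)) =ᶠ[𝓝 0] fun s => f (Γ (κ s) (κ s)) :=
    hκ.mono fun s hs => by simp only [hs]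
  rw [deriv_congr_nhds e1, deriv_congr_nhds e2]
  exact h2.congr_tvs e3

omit [ConvenientSpace E] in
theorem PlanarSmoothFamily.exists_curveSmoothOn_deriv_comp {Γ : ℝ → ℝ → E}
    (hΓ : PlanarSmoothFamily Γ) (hU : CInfOpen U) (hf : SmoothMapOn U f) (h0 : Γ 0 0 ∈ U) :
    ∃ w : ℝ → G, CurveSmoothOn univ w ∧
      ∀ᶠ t in 𝓝 0, w t = deriv (fun s => f (Γ s t)) 0 := by
  obtain ⟨κ, hκ0, hκ, hH⟩ := hΓ.exists_comp hU hf h0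
  refine ⟨_, hH.curveSmoothOn_deriv, hκ.mono fun t ht => ?_⟩
  rw [ht]
  exact deriv_congr_nhds (hκ.mono fun s hs => by simp only [hs])

/-- The difference quotient of a smooth curve is smooth. -/
theorem CurveSmoothOn.exists_slope {c : ℝ → E} (hc : CurveSmoothOn univ c) :
    ∃ g : ℝ → E, CurveSmoothOn univ g ∧ g 0 = _root_.deriv c 0 ∧ ∀ t, c t = c 0 + t • g t := by
  classical
  refine ⟨fun t => if t = 0 then _root_.deriv c 0 else t⁻¹ • (c t - c 0), ?_, by simp, fun t => ?_⟩
  · rw [curveSmoothOn_univ_iff_dual] at hc ⊢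
    intro l
    convert! contDiff_dslope_zero (hc l) using 1
    funext t
    rcases eq_or_ne t 0 with rfl | ht
    · have := ((curveSmoothOn_univ_iff_dual.2 hc).hasDerivAt (mem_univ 0)).clm_comp_tvs l
      simp [this.deriv]
    · rw [dslope_of_ne _ ht, if_neg ht, slope_def_module]
      simp
  · rcases eq_or_ne t 0 with rfl | ht
    · simp
    · simp [ht]

/-- The chain rule along curves. -/
theorem SmoothMapOn.hasDerivAt_comp (hU : CInfOpen U) (hf : SmoothMapOn U f) {J : Set ℝ}
    (hJ : IsOpen J) {c : ℝ → E} (hc : CurveSmoothOn J c) {t : ℝ} (ht : t ∈ J) (hct : c t ∈ U) :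
    HasDerivAt (fun s => f (c s)) (dirDeriv f (c t) (deriv c t)) t := by
  obtain ⟨c', hc', hcc⟩ := hc.exists_global hJ ht
  have h0 : c' 0 = c t := by simpa using hcc.self_of_nhds
  have hd : deriv c' 0 = deriv c t := by
    have h1 := hasDerivAt_shift_iff.2 (hc.hasDerivAt ht)
    exact (h1.congr_tvs hcc).deriv_tvs
  obtain ⟨g, hg, hg0, hgc⟩ := hc'.exists_slope
  -- With `g` the slope of `c'`, the diagonal of this family is `c'`, the edge `t = 0` is the
  -- tangent line, and the edge `s = 0` is constant and contributes nothing.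
  have hΓ : PlanarSmoothFamily fun s t => c' 0 + s • g t := fun a b ha hb =>
    curveSmoothOn_add_smul isOpen_univ (curveSmoothOn_const _ _) ha.contDiffOn
      (hg.comp_contDiffOn isOpen_univ isOpen_univ hb.contDiffOn (mapsTo_univ _ _))
  have key := hΓ.hasDerivAt_comp_diag hU hf (by simpa [h0] using hct)
  have hconst : deriv (fun s : ℝ => f (c' 0 + (0 : ℝ) • g s)) 0 = 0 := by
    have : HasDerivAt (fun s : ℝ => f (c' 0 + (0 : ℝ) • g s)) 0 0 := by
      rw [hasDerivAt_iff_tendsto_slope_tvs]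
      simp
    exact this.deriv_tvs
  rw [hconst, add_zero, hg0, hd, h0] at key
  rw [← hasDerivAt_shift_iff]
  refine key.congr_tvs (hcc.mono fun s hs => ?_)
  change f (c (t + s)) = f (c t + s • g s)
  rw [← h0, ← hgc, hs]

theorem SmoothMapOn.hasDerivAt_line (hU : CInfOpen U) (hf : SmoothMapOn U f) {u : E} (hu : u ∈ U)
    (v : E) : HasDerivAt (fun t : ℝ => f (u + t • v)) (dirDeriv f u v) 0 := by
  have := hf.hasDerivAt_comp hU isOpen_univ (curveSmoothOn_line u v) (mem_univ 0)
    (by simpa using hu)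
  rwa [show dirDeriv f u v = deriv (fun t : ℝ => f (u + t • v)) 0 from rfl, this.deriv_tvs]

theorem SmoothMapOn.dirDeriv_add (hU : CInfOpen U) (hf : SmoothMapOn U f) {u : E} (hu : u ∈ U)
    (v w : E) : dirDeriv f u (v + w) = dirDeriv f u v + dirDeriv f u w := by
  have hΓ : PlanarSmoothFamily fun s t : ℝ => u + s • v + t • w := fun a b ha hb =>
    curveSmoothOn_add_smul isOpen_univ (curveSmoothOn_add_smul isOpen_univ
      (curveSmoothOn_const _ _) ha.contDiffOn (curveSmoothOn_const _ _)) hb.contDiffOn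
      (curveSmoothOn_const _ _)
  have key := (hΓ.hasDerivAt_comp_diag hU hf (by simpa using hu)).deriv_tvs
  simp only [zero_smul, add_zero, add_assoc, ← smul_add] at key
  exact key

theorem SmoothMapOn.dirDeriv_smul (hU : CInfOpen U) (hf : SmoothMapOn U f) {u : E} (hu : u ∈ U)
    (a : ℝ) (v : E) : dirDeriv f u (a • v) = a • dirDeriv f u v := by
  rw [SeparatingDual.eq_iff_forall_dual_eq (R := ℝ)]
  intro l
  have h1 := (hf.hasDerivAt_line hU hu v).clm_comp_tvs l
  have h2 := (hf.hasDerivAt_line hU hu (a • v)).clm_comp_tvs l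
  have h3 : HasDerivAt (fun t : ℝ => a * t) a 0 := by
    simpa using (hasDerivAt_id (0 : ℝ)).const_mul a
  have h4 := HasDerivAt.comp (0 : ℝ) (h := fun t : ℝ => a * t)
    (h₂ := fun t : ℝ => l (f (u + t • v))) (by simpa using h1) h3
  have h5 : (fun t : ℝ => l (f (u + t • v))) ∘ (fun t : ℝ => a * t) =
      fun t : ℝ => l (f (u + t • a • v)) := by
    funext t
    simp [smul_smul, mul_comm]
  rw [h5] at h4
  rw [h2.unique h4, map_smul, smul_eq_mul, mul_comm]

/-- The derivative of a smooth map as a linear map. -/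
def SmoothMapOn.dirDerivLinear (hU : CInfOpen U) (hf : SmoothMapOn U f) {u : E} (hu : u ∈ U) :
    E →ₗ[ℝ] G where
  toFun := dirDeriv f u
  map_add' := hf.dirDeriv_add hU hu
  map_smul' := hf.dirDeriv_smul hU hu

/-- This is the transversal derivative at `s = 0` of `f` along the family `c t + s • w t`. -/
theorem SmoothMapOn.curveSmoothOn_dirDeriv (hU : CInfOpen U) (hf : SmoothMapOn U f) {J : Set ℝ}
    (hJ : IsOpen J) {c w : ℝ → E} (hc : CurveSmoothOn J c) (hw : CurveSmoothOn J w)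
    (hcU : MapsTo c J U) : CurveSmoothOn J fun t => dirDeriv f (c t) (w t) := by
  refine .of_locally fun t₀ ht₀ => ?_
  obtain ⟨c', hc', hcc⟩ := hc.exists_global hJ ht₀
  obtain ⟨w', hw', hww⟩ := hw.exists_global hJ ht₀
  have h0 : c' 0 = c t₀ := by simpa using hcc.self_of_nhds
  have hΓ : PlanarSmoothFamily fun s t : ℝ => c' t + s • w' t := fun a b ha hb =>
    curveSmoothOn_add_smul isOpen_univ
      (hc'.comp_contDiffOn isOpen_univ isOpen_univ hb.contDiffOn (mapsTo_univ _ _)) ha.contDiffOn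
      (hw'.comp_contDiffOn isOpen_univ isOpen_univ hb.contDiffOn (mapsTo_univ _ _))
  obtain ⟨d, hd, hdd⟩ := hΓ.exists_curveSmoothOn_deriv_comp hU hf
    (by simpa [h0] using hcU ht₀)
  refine ⟨univ, fun t => d (t - t₀), mem_univ _, hd.comp_contDiffOn isOpen_univ isOpen_univ
    (contDiff_id.sub contDiff_const).contDiffOn (mapsTo_univ _ _), ?_⟩
  have hlim : Tendsto (fun t => t - t₀) (𝓝 t₀) (𝓝 0) := by
    simpa using (tendsto_id (x := 𝓝 t₀)).sub_const t₀
  filter_upwards [hlim.eventually hcc, hlim.eventually hww, hlim.eventually hdd] with t h1 h2 h3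
  rw [add_sub_cancel] at h1 h2
  rw [h3, h1, h2]
  rfl

/-- The chain rule for directional derivatives. -/
theorem dirDeriv_comp {H : Type*} [AddCommGroup H] [Module ℝ H] [TopologicalSpace H]
    [ConvenientSpace H] {V : Set G} {g : G → H} {k : E → H} (hU : CInfOpen U)
    (hf : SmoothMapOn U f) (hV : CInfOpen V) (hg : SmoothMapOn V g)
    (hk : ∀ u ∈ U, f u ∈ V → k u = g (f u)) {u : E} (hu : u ∈ U) (hfu : f u ∈ V) (v : E) :
    dirDeriv k u v = dirDeriv g (f u) (dirDeriv f u v) := by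
  have hl := curveSmoothOn_line u v
  set c : ℝ → E := fun t => u + t • v with hc
  have hc0 : c 0 = u := by simp [hc]
  set J := univ ∩ c ⁻¹' U with hJ
  have hJo : IsOpen J := hU _ _ isOpen_univ hl
  have h0J : (0 : ℝ) ∈ J := ⟨mem_univ _, by rw [mem_preimage, hc0]; exact hu⟩
  have hfc : CurveSmoothOn J (f ∘ c) := hf J c hJo (hl.mono (subset_univ _)) fun t ht => ht.2
  have hJ'o : IsOpen (J ∩ (f ∘ c) ⁻¹' V) := hV _ _ hJo hfc
  have h0 : (f ∘ c) 0 = f u := by rw [Function.comp_apply, hc0]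
  have key := hg.hasDerivAt_comp hV hJo hfc h0J (by rw [h0]; exact hfu)
  rw [h0] at key
  exact (key.congr_tvs (eventually_of_mem (hJ'o.mem_nhds ⟨h0J, by
    rw [mem_preimage, h0]; exact hfu⟩) fun t ht => hk _ ht.1.2 ht.2)).deriv_tvs

/-- A linear form that is continuous along smooth curves is bounded. -/
theorem boundedLinear_of_continuous_curves {L : E →ₗ[ℝ] ℝ}
    (hL : ∀ c : ℝ → E, CurveSmoothOn univ c → Continuous fun t => L (c t)) : BoundedLinear L := by
  obtain ⟨a, τ, ha, hτ, hcurve⟩ := exists_special_curve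
  intro B hB
  rw [NormedSpace.isVonNBounded_iff, isBounded_iff_forall_norm_le]
  by_contra! hcon
  -- A special curve passes through `a k • v k` at time `τ k → 0`, where `L` exceeds `k` in absolute
  -- value.
  have hcon' : ∀ k : ℕ, ∃ v ∈ B, k / a k < |L v| := fun k => by
    obtain ⟨_, ⟨v, hv, rfl⟩, h⟩ := hcon (k / a k)
    exact ⟨v, hv, h⟩
  choose v hvB hv using hcon'
  obtain ⟨c, hc, hc0, hcτ⟩ := hcurve (B ∪ {0}) (hB.union (Bornology.isVonNBounded_singleton _)) v
    (fun _ => 0) (fun k => Or.inl (hvB k)) fun _ => Or.inr rfl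
  have hlim := (((hL c hc).tendsto 0).comp hτ).abs
  refine not_tendsto_nhds_of_tendsto_atTop (tendsto_atTop_mono (fun k => ?_)
    tendsto_natCast_atTop_atTop) _ hlim
  have h1 := (hcτ k).self_of_nhds
  rw [smul_zero, add_zero] at h1
  rw [Function.comp_apply, h1, map_smul, smul_eq_mul, abs_mul, abs_of_pos (ha k), mul_comm]
  exact ((div_lt_iff₀ (ha k)).1 (hv k)).le

theorem SmoothMapOn.boundedLinear_dirDeriv {f : E → ℝ} (hU : CInfOpen U) (hf : SmoothMapOn U f)
    {u : E} (hu : u ∈ U) : BoundedLinear (hf.dirDerivLinear hU hu) :=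
  boundedLinear_of_continuous_curves fun _ hc => continuousOn_univ.1
    (hf.curveSmoothOn_dirDeriv hU isOpen_univ (curveSmoothOn_const _ u) hc
      fun _ _ => hu).continuousOn

end SmoothMaps

/-! ### Curves and functions in charts. -/

section Charts

variable {E : Type*} [AddCommGroup E] [Module ℝ E] [TopologicalSpace E]
  {M : Type*} [TopologicalSpace M]

theorem CurveSmoothOn.continuousOn_cInf {J : Set ℝ} (hJ : IsOpen J) {c : ℝ → E}
    (hc : CurveSmoothOn J c) : ContinuousOn (fun t => CInf.of (c t)) J :=
  (continuousOn_open_iff hJ).2 fun _ hO => hO J c hJ hc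

theorem cInfOpen_chart (φ : OpenPartialHomeomorph M (CInf E)) {O : Set M} (hO : IsOpen O) :
    CInfOpen {u : E | CInf.of u ∈ φ.target ∧ φ.symm (CInf.of u) ∈ O} :=
  (φ.symm.isOpen_inter_preimage hO).cInfOpen

theorem mem_chart_image {φ : OpenPartialHomeomorph M (CInf E)} {O : Set M} {x : M}
    (hx : x ∈ φ.source) (hO : x ∈ O) :
    (φ x).out ∈ {u : E | CInf.of u ∈ φ.target ∧ φ.symm (CInf.of u) ∈ O} :=
  ⟨φ.map_source hx, (φ.left_inv hx).symm ▸ hO⟩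

variable [ChartedSpace (CInf E) M]

theorem MCurveSmoothOn.isOpen_inter {J : Set ℝ} (hJ : IsOpen J) {c : ℝ → M}
    (hc : MCurveSmoothOn E J c) {O : Set M} (hO : IsOpen O) : IsOpen (J ∩ c ⁻¹' O) :=
  hc.1.isOpen_inter_preimage hJ hO

theorem MCurveSmoothOn.mono {J J' : Set ℝ} {c : ℝ → M} (hc : MCurveSmoothOn E J c)
    (hJ : J' ⊆ J) : MCurveSmoothOn E J' c :=
  ⟨hc.1.mono hJ, fun φ hφ => (hc.2 φ hφ).mono (inter_subset_inter_left _ hJ)⟩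

theorem MCurveSmoothOn.congr {J : Set ℝ} (hJ : IsOpen J) {c c' : ℝ → M}
    (hc : MCurveSmoothOn E J c) (h : ∀ t ∈ J, c' t = c t) : MCurveSmoothOn E J c' := by
  have hset : ∀ O : Set M, J ∩ c' ⁻¹' O = J ∩ c ⁻¹' O := fun O => by
    ext t
    simp only [mem_inter_iff, mem_preimage]
    exact and_congr_right fun ht => by rw [h t ht]
  refine ⟨hc.1.congr h, fun φ hφ => ?_⟩
  rw [hset]
  exact (hc.2 φ hφ).congr (hc.isOpen_inter hJ φ.open_source) fun t ht => by rw [h t ht.1]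

theorem mCurveSmoothOn_const (J : Set ℝ) (x : M) : MCurveSmoothOn E J (fun _ => x) :=
  ⟨continuousOn_const, fun _ _ => curveSmoothOn_const _ _⟩

/-- A smooth curve in the target of a chart gives a smooth curve in the manifold. -/
theorem IsChart.mCurveSmoothOn_symm {φ : OpenPartialHomeomorph M (CInf E)} (hφ : IsChart φ)
    {J : Set ℝ} (hJ : IsOpen J) {c : ℝ → E} (hc : CurveSmoothOn J c)
    (hm : ∀ t ∈ J, CInf.of (c t) ∈ φ.target) :
    MCurveSmoothOn E J (fun t => φ.symm (CInf.of (c t))) := by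
  have hcont : ContinuousOn (fun t => φ.symm (CInf.of (c t))) J :=
    φ.symm.continuousOn.comp (hc.continuousOn_cInf hJ) hm
  refine ⟨hcont, fun ψ hψ => ?_⟩
  exact (hφ ψ hψ).1 _ _ (hcont.isOpen_inter_preimage hJ ψ.open_source)
    (hc.mono inter_subset_left) fun t ht => ⟨hm t ht.1, ht.2⟩

/-- The coordinates of a smooth curve in an arbitrary chart are smooth. -/
theorem IsChart.curveSmoothOn {φ : OpenPartialHomeomorph M (CInf E)} (hφ : IsChart φ)
    {J : Set ℝ} (hJ : IsOpen J) {c : ℝ → M} (hc : MCurveSmoothOn E J c) :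
    CurveSmoothOn (J ∩ c ⁻¹' φ.source) (fun t => (φ (c t)).out) := by
  refine .of_locally fun t₀ ht₀ => ?_
  set χ := chartAt (CInf E) (c t₀)
  have hχ : χ ∈ atlas (CInf E) M := chart_mem_atlas _ _
  have hJ' := hc.isOpen_inter hJ (χ.open_source.inter φ.open_source)
  have ht₀' : t₀ ∈ J ∩ c ⁻¹' (χ.source ∩ φ.source) := ⟨ht₀.1, mem_chart_source _ _, ht₀.2⟩
  refine ⟨_, _, ht₀', (hφ χ hχ).2 _ (fun t => (χ (c t)).out) hJ'
    ((hc.2 χ hχ).mono (inter_subset_inter_right _ (preimage_mono inter_subset_left)))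
    (fun t ht => mem_chart_image ht.2.1 ht.2.2), eventually_of_mem (hJ'.mem_nhds ht₀') ?_⟩
  intro t ht
  change (φ (c t)).out = (φ (χ.symm (χ (c t)))).out
  rw [χ.left_inv ht.2.1]

theorem isChart_of_mem_atlas [ConvenientManifold E M] {φ : OpenPartialHomeomorph M (CInf E)}
    (hφ : φ ∈ atlas (CInf E) M) : IsChart φ := fun ψ hψ =>
  ConvenientManifold.compatible φ hφ ψ hψ

theorem isChart_chartAt [ConvenientManifold E M] (x : M) : IsChart (chartAt (CInf E) x) :=
  isChart_of_mem_atlas (chart_mem_atlas _ _)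

/-- Smooth functions are smooth in charts. -/
theorem SmoothFunOn.smoothMapOn {V : Set M} {f : M → ℝ} (hf : SmoothFunOn E V f)
    {φ : OpenPartialHomeomorph M (CInf E)} (hφ : IsChart φ) :
    SmoothMapOn {u : E | CInf.of u ∈ φ.target ∧ φ.symm (CInf.of u) ∈ V}
      (fun u => f (φ.symm (CInf.of u))) := fun J _ hJ hc hm =>
  hf J _ hJ (hφ.mCurveSmoothOn_symm hJ hc fun _ ht => (hm ht).1) fun _ ht => (hm ht).2

theorem dFun_congr [ConvenientSpace E] {V : Set M} (hV : IsOpen V) {f g : M → ℝ}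
    (h : ∀ x ∈ V, f x = g x) {x : M} (hx : x ∈ V) (v : TSpace E x) : dFun f x v = dFun g x v := by
  have hopen := cInfOpen_chart (chartAt (CInf E) x) hV univ _ isOpen_univ
    (curveSmoothOn_line (chartAt (CInf E) x x).out v)
  refine deriv_congr_nhds (eventually_of_mem (hopen.mem_nhds ⟨mem_univ _, ?_⟩) fun t ht =>
    h _ ht.2.2)
  rw [mem_preimage, zero_smul, add_zero]
  exact mem_chart_image (mem_chart_source _ _) hx

/-- The differential of a smooth function, as a cotangent vector. -/
theorem SmoothFunOn.exists_cotangent [ConvenientSpace E] [ConvenientManifold E M] {V : Set M}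
    (hV : IsOpen V) {f : M → ℝ} (hf : SmoothFunOn E V f) {x : M} (hx : x ∈ V) :
    ∃ ξ : CotSpace E x, ∀ v : TSpace E x, ξ v = dFun f x v :=
  ⟨⟨_, (hf.smoothMapOn (isChart_chartAt x)).boundedLinear_dirDeriv (cInfOpen_chart _ hV)
    (mem_chart_image (mem_chart_source _ _) hx)⟩, fun _ => rfl⟩

end Charts

/-! ### Tangent maps, and lifting curves through submersions. -/

section Maps

variable {E : Type*} [AddCommGroup E] [Module ℝ E] [TopologicalSpace E] [ConvenientSpace E]
  {M : Type*} [TopologicalSpace M] [ChartedSpace (CInf E) M] [ConvenientManifold E M]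
  {E' : Type*} [AddCommGroup E'] [Module ℝ E'] [TopologicalSpace E'] [ConvenientSpace E']
  {M' : Type*} [TopologicalSpace M'] [ChartedSpace (CInf E') M'] [ConvenientManifold E' M']
  {j : M → M'}

-- In charts the topology of `M` is the `c^∞`-topology, so openness of a preimage may be tested
-- along smooth curves, which `j` maps to continuous curves.
omit [ConvenientSpace E] [ConvenientSpace E'] [ConvenientManifold E' M'] in
theorem SmoothMap.continuous (hj : SmoothMap E E' j) : Continuous j := by
  refine ⟨fun V hV => isOpen_iff_mem_nhds.2 fun x hx => ?_⟩
  set φ := chartAt (CInf E) x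
  have hO : IsOpen {e : CInf E | e ∈ φ.target ∧ j (φ.symm e) ∈ V} := fun J c hJ hc => by
    have hJ' : IsOpen (J ∩ (fun t => CInf.of (c t)) ⁻¹' φ.target) := φ.open_target J c hJ hc
    have hc' := (isChart_chartAt x).mCurveSmoothOn_symm hJ' (hc.mono inter_subset_left)
      fun t ht => ht.2
    have := (hj _ _ hJ' hc').isOpen_inter hJ' hV
    rwa [inter_assoc] at this
  filter_upwards [(φ.isOpen_inter_preimage hO).mem_nhds ⟨mem_chart_source _ x,
    φ.map_source (mem_chart_source _ x), by rwa [φ.left_inv (mem_chart_source _ x)]⟩]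
    with y hy
  have := hy.2.2
  rwa [φ.left_inv hy.1] at this

omit [ConvenientSpace E] [ConvenientSpace E'] [ConvenientManifold E M]
  [ConvenientManifold E' M'] in
/-- Smooth maps are smooth in charts. -/
theorem SmoothMap.smoothMapOn (hj : SmoothMap E E' j)
    {φ : OpenPartialHomeomorph M (CInf E)} (hφ : IsChart φ)
    {ψ : OpenPartialHomeomorph M' (CInf E')} (hψ : IsChart ψ) :
    SmoothMapOn {u : E | CInf.of u ∈ φ.target ∧ φ.symm (CInf.of u) ∈ j ⁻¹' ψ.source}
      (fun u => (ψ (j (φ.symm (CInf.of u)))).out) := fun _ _ hJ hc hm =>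
  (hψ.curveSmoothOn hJ (hj _ _ hJ (hφ.mCurveSmoothOn_symm hJ hc fun _ ht => (hm ht).1))).mono
    fun _ ht => ⟨ht, (hm ht).2⟩

/-- The tangent map in coordinates. -/
theorem SmoothMap.tangentCoord_dMap (hj : SmoothMap E E' j)
    {χ : OpenPartialHomeomorph M (CInf E)} (hχ : χ ∈ atlas (CInf E) M)
    {ψ : OpenPartialHomeomorph M' (CInf E')} (hψ : ψ ∈ atlas (CInf E') M') {x : M}
    (hx : x ∈ χ.source) (hjx : j x ∈ ψ.source) (v : TSpace E x) :
    tangentCoord ψ (j x) (dMap (E' := E') j x v) =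
      dirDeriv (fun u : E => (ψ (j (χ.symm (CInf.of u)))).out) (χ x).out (tangentCoord χ x v) := by
  set α := chartAt (CInf E) x with hα
  set β := chartAt (CInf E') (j x) with hβ
  have hxα : x ∈ α.source := mem_chart_source _ _
  have hxβ : j x ∈ β.source := mem_chart_source _ _
  have hαβ : (β (j (α.symm (CInf.of (α x).out)))).out = (β (j x)).out :=
    congrArg (fun y => (β (j y)).out) (α.left_inv hxα)
  have hαχ : transition α χ (α x).out = (χ x).out :=
    congrArg (fun y => (χ y).out) (α.left_inv hxα)
  have hc := hj.continuous
  -- The same local expression of `j` is differentiated twice: factored through the preferred chart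
  -- at `j x`, and then through `χ`.
  have h1 := dirDeriv_comp (k := fun u : E => (ψ (j (α.symm (CInf.of u)))).out)
    (cInfOpen_chart α (β.open_source.preimage hc))
    (hj.smoothMapOn (isChart_chartAt x) (isChart_chartAt (j x)))
    (cInfOpen_chart β ψ.open_source) ((isChart_chartAt (j x)) ψ hψ).1
    (fun u hu _ => congrArg (fun y => (ψ y).out) (β.left_inv hu.2).symm)
    (mem_chart_image hxα hxβ) (by rw [hαβ]; exact mem_chart_image hxβ hjx) v
  have h2 := dirDeriv_comp (k := fun u : E => (ψ (j (α.symm (CInf.of u)))).out)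
    (cInfOpen_chart α χ.open_source) ((isChart_chartAt x) χ hχ).1
    (cInfOpen_chart χ (ψ.open_source.preimage hc))
    (hj.smoothMapOn (isChart_of_mem_atlas hχ) (isChart_of_mem_atlas hψ))
    (fun u hu _ => congrArg (fun y => (ψ (j y)).out) (χ.left_inv hu.2).symm)
    (mem_chart_image hxα hx) (by rw [hαχ]; exact mem_chart_image hx hjx) v
  rw [hαβ] at h1
  rw [hαχ] at h2
  exact h1.symm.trans h2

/-- The tangent map is linear. -/
theorem SmoothMap.exists_linearMap_eq_dMap (hj : SmoothMap E E' j) (x : M) :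
    ∃ L : TSpace E x →ₗ[ℝ] E', ∀ v, L v = (dMap (E' := E') j x v : E') :=
  ⟨(hj.smoothMapOn (isChart_chartAt x) (isChart_chartAt (j x))).dirDerivLinear
    (cInfOpen_chart _ ((chartAt (CInf E') (j x)).open_source.preimage hj.continuous))
    (mem_chart_image (mem_chart_source _ _) (mem_chart_source _ _)), fun _ => rfl⟩

/-- The chain rule for functions. -/
theorem SmoothMap.dFun_comp (hj : SmoothMap E E' j) {V : Set M'} (hV : IsOpen V) {f : M' → ℝ}
    (hf : SmoothFunOn E' V f) {x : M} (hx : j x ∈ V) (v : TSpace E x) :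
    dFun (f ∘ j) x v = dFun f (j x) (dMap (E' := E') j x v) := by
  set α := chartAt (CInf E) x with hα
  set β := chartAt (CInf E') (j x) with hβ
  have hxα : x ∈ α.source := mem_chart_source _ _
  have hxβ : j x ∈ β.source := mem_chart_source _ _
  have hαβ : (β (j (α.symm (CInf.of (α x).out)))).out = (β (j x)).out :=
    congrArg (fun y => (β (j y)).out) (α.left_inv hxα)
  have h1 := dirDeriv_comp (k := fun u : E => f (j (α.symm (CInf.of u))))
    (cInfOpen_chart α (β.open_source.preimage hj.continuous))
    (hj.smoothMapOn (isChart_chartAt x) (isChart_chartAt (j x)))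
    (cInfOpen_chart β hV) (hf.smoothMapOn (isChart_chartAt (j x)))
    (fun u hu _ => congrArg f (β.left_inv hu.2).symm)
    (mem_chart_image hxα hxβ) (by rw [hαβ]; exact mem_chart_image hxβ hx) v
  rw [hαβ] at h1
  exact h1

omit [ConvenientSpace E] [ConvenientManifold E M] [ConvenientSpace E']
  [ConvenientManifold E' M'] in
theorem SmoothMap.smoothFunOn_comp (hj : SmoothMap E E' j) {V : Set M'} {f : M' → ℝ}
    (hf : SmoothFunOn E' V f) : SmoothFunOn E (j ⁻¹' V) (f ∘ j) := fun J c hJ hc hm =>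
  hf J (j ∘ c) hJ (hj J c hJ hc) hm

/-- The tangent map maps smooth curves in the tangent bundle to smooth curves. -/
theorem SmoothMap.tangentCurveSmoothOn (hj : SmoothMap E E' j) {J : Set ℝ} (hJ : IsOpen J)
    {c : ℝ → M} {w : ∀ t, TSpace E (c t)} (hw : TangentCurveSmoothOn J c w) :
    TangentCurveSmoothOn J (fun t => j (c t)) (fun t => dMap (E' := E') j (c t) (w t)) := by
  have hc := hj J c hJ hw.1
  refine ⟨hc, fun ψ hψ => .of_locally fun t₀ ht₀ => ?_⟩
  set χ := chartAt (CInf E) (c t₀)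
  have hχ : χ ∈ atlas (CInf E) M := chart_mem_atlas _ _
  have hop := ψ.open_source.preimage hj.continuous
  have hJ' := hw.1.isOpen_inter hJ (χ.open_source.inter hop)
  have ht₀' : t₀ ∈ J ∩ c ⁻¹' (χ.source ∩ j ⁻¹' ψ.source) := ⟨ht₀.1, mem_chart_source _ _, ht₀.2⟩
  have hsub : J ∩ c ⁻¹' (χ.source ∩ j ⁻¹' ψ.source) ⊆ J ∩ c ⁻¹' χ.source :=
    inter_subset_inter_right _ (preimage_mono inter_subset_left)
  refine ⟨_, _, ht₀', (hj.smoothMapOn (isChart_of_mem_atlas hχ)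
    (isChart_of_mem_atlas hψ)).curveSmoothOn_dirDeriv (cInfOpen_chart χ hop) hJ'
    ((hw.1.2 χ hχ).mono hsub) ((hw.2 χ hχ).mono hsub)
    (fun t ht => mem_chart_image ht.2.1 ht.2.2), eventually_of_mem (hJ'.mem_nhds ht₀') ?_⟩
  intro t ht
  exact hj.tangentCoord_dMap hχ hψ ht.2.1 ht.2.2 (w t)

omit [ConvenientManifold E M] [ConvenientManifold E' M'] in
/-- Smooth curves can be lifted locally through submersions. -/
theorem IsSubmersion.exists_lift (hj : IsSubmersion E E' j) {J : Set ℝ} (hJ : IsOpen J)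
    {c' : ℝ → M'} (hc' : MCurveSmoothOn E' J c') {t₀ : ℝ} (ht₀ : t₀ ∈ J) {x₀ : M}
    (hx₀ : j x₀ = c' t₀) :
    ∃ (J₀ : Set ℝ) (c : ℝ → M), IsOpen J₀ ∧ t₀ ∈ J₀ ∧ J₀ ⊆ J ∧ MCurveSmoothOn E J₀ c ∧
      ∀ t ∈ J₀, j (c t) = c' t := by
  obtain ⟨-, hloc⟩ := hj
  obtain ⟨φ, ψ, π, s, hφ, hψ, hx, hm, hπ, hs, hπs, heq⟩ := hloc x₀
  have hJ₁ := hc'.isOpen_inter hJ ψ.open_source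
  have hψc := hψ.curveSmoothOn hJ hc'
  set J₁ := J ∩ c' ⁻¹' ψ.source with hJ₁def
  have ht₁ : t₀ ∈ J₁ := ⟨ht₀, by rw [mem_preimage, ← hx₀]; exact hm hx⟩
  -- The section `s` lifts the curve; the constant correction, which lies in the kernel of `π`,
  -- makes the lift start at `x₀`.
  set γ : ℝ → E := fun t => ((φ x₀).out - s (ψ (c' t₀)).out) + (1 : ℝ) • s (ψ (c' t)).out with hγ
  have hγs : CurveSmoothOn J₁ γ := curveSmoothOn_add_smul hJ₁ (curveSmoothOn_const _ _)
    contDiffOn_const (hs.comp_curveSmoothOn hJ₁ hψc)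
  have hγ0 : γ t₀ = (φ x₀).out := by simp [hγ]
  have hJ₂ : IsOpen (J₁ ∩ (fun t => CInf.of (γ t)) ⁻¹' φ.target) := φ.open_target J₁ γ hJ₁ hγs
  refine ⟨_, fun t => φ.symm (CInf.of (γ t)), hJ₂, ⟨ht₁, ?_⟩,
    inter_subset_left.trans inter_subset_left,
    hφ.mCurveSmoothOn_symm hJ₂ (hγs.mono inter_subset_left) fun t ht => ht.2, fun t ht => ?_⟩
  · rw [mem_preimage, hγ0]
    exact φ.map_source hx
  · have hsrc : φ.symm (CInf.of (γ t)) ∈ φ.source := φ.map_target ht.2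
    refine ψ.injOn (hm hsrc) ht.1.2 ?_
    have h1 := heq _ hsrc
    rw [φ.right_inv ht.2] at h1
    have h2 : π (γ t) = (ψ (c' t)).out := by
      rw [hγ]
      simp only [map_add, map_sub, hπs, one_smul, ← heq x₀ hx, hx₀, sub_self, zero_add]
    exact h1.trans h2

end Maps

/-! ### Sections of weak subbundles; locality of the bracket. -/

section Subbundle

variable {E : Type*} [AddCommGroup E] [Module ℝ E] [TopologicalSpace E]
  {M : Type*} [TopologicalSpace M] [ChartedSpace (CInf E) M]
  {F : Type*} [AddCommGroup F] [Module ℝ F] [TopologicalSpace F]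

omit [TopologicalSpace M] [ChartedSpace (CInf E) M] in
theorem cotSpace_ext {x : M} {ξ η : CotSpace E x} (h : ∀ v : TSpace E x, ξ v = η v) : ξ = η :=
  Subtype.ext (LinearMap.ext h)

omit [TopologicalSpace M] [ChartedSpace (CInf E) M] in
theorem cotSpace_congr (α : ∀ x : M, CotSpace E x) {x y : M} (h : x = y) (v : E) :
    α x v = α y v := by
  subst h
  rfl

theorem tangentCoord_congr (φ : OpenPartialHomeomorph M (CInf E)) {x y : M} (h : x = y) {v w : E}
    (hv : v = w) : tangentCoord φ x v = tangentCoord φ y w := by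
  subst h hv
  rfl

namespace WeakSubbundle

variable {T : WeakSubbundle E M F}

theorem CurveSmoothOn.mono {J J' : Set ℝ} {c : ℝ → M} {ξ : ∀ t, CotSpace E (c t)}
    (h : T.CurveSmoothOn J c ξ) (hJ : J' ⊆ J) : T.CurveSmoothOn J' c ξ := by
  refine ⟨h.1.mono hJ, fun x₀ => ?_⟩
  obtain ⟨v, hv, hv'⟩ := h.2 x₀
  exact ⟨v, hv.mono (inter_subset_inter_left _ hJ), fun t ht => hv' t ⟨hJ ht.1, ht.2⟩⟩

theorem CurveSmoothOn.congr {J : Set ℝ} (hJ : IsOpen J) {c c' : ℝ → M}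
    {ξ : ∀ t, CotSpace E (c t)} {ξ' : ∀ t, CotSpace E (c' t)} (h : T.CurveSmoothOn J c ξ)
    (hc : ∀ t ∈ J, c' t = c t) (hξ : ∀ t ∈ J, ∀ v : E, ξ' t v = ξ t v) :
    T.CurveSmoothOn J c' ξ' := by
  refine ⟨h.1.congr hJ hc, fun x₀ => ?_⟩
  obtain ⟨v, hv, hv'⟩ := h.2 x₀
  have hset : J ∩ c' ⁻¹' T.base x₀ = J ∩ c ⁻¹' T.base x₀ := by
    ext t
    simp only [mem_inter_iff, mem_preimage]
    exact and_congr_right fun ht => by rw [hc t ht]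
  rw [hset]
  refine ⟨v, hv, fun t ht => cotSpace_ext fun w => ?_⟩
  rw [hξ t ht.1, hv' t ht]
  exact (cotSpace_congr (fun x => T.triv x₀ x (v t)) (hc t ht.1) w).symm

theorem CurveSmoothOn.mem_fiber {J : Set ℝ} {c : ℝ → M} {ξ : ∀ t, CotSpace E (c t)}
    (h : T.CurveSmoothOn J c ξ) {t : ℝ} (ht : t ∈ J) : ξ t ∈ T.fiber (c t) := by
  obtain ⟨v, -, hv⟩ := h.2 (c t)
  have hb := T.mem_base (c t)
  rw [← T.range_triv (c t) (c t) hb, hv t ⟨ht, hb⟩]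
  exact LinearMap.mem_range_self _ _

theorem SectionOn.mem_fiber {U : Set M} {α : ∀ x : M, CotSpace E x} (h : T.SectionOn U α) {x : M}
    (hx : x ∈ U) : α x ∈ T.fiber x :=
  (h univ (fun _ => x) isOpen_univ (mCurveSmoothOn_const _ _) fun _ _ => hx).mem_fiber
    (mem_univ 0)

/-- Every element of the subbundle extends to a local section. -/
theorem exists_section (T : WeakSubbundle E M F) {y : M} {ξ : CotSpace E y}
    (hξ : ξ ∈ T.fiber y) : ∃ (V : Set M) (α : ∀ x : M, CotSpace E x), IsOpen V ∧ y ∈ V ∧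
      T.SectionOn V α ∧ SmoothFormOn V α ∧ α y = ξ := by
  classical
  rw [← T.range_triv y y (T.mem_base y)] at hξ
  obtain ⟨v, hv⟩ := hξ
  refine ⟨T.base y, fun x => T.triv y x v, T.isOpen_base y, T.mem_base y,
    fun J c hJ hc hm => ⟨hc, fun x₀ => ?_⟩, fun J c hJ hc hm =>
    T.smooth_incl y J c (fun _ => v) hJ hc hm (curveSmoothOn_const _ _), hv⟩
  -- The section is constant in the trivialisation at `y`. Its coordinates in another trivialisation
  -- are chosen pointwise; `smooth_transition` makes them smooth.
  have hex : ∀ t : ℝ, ∃ w : F, t ∈ J ∩ c ⁻¹' T.base x₀ →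
      T.triv y (c t) v = T.triv x₀ (c t) w := fun t => by
    by_cases ht : t ∈ J ∩ c ⁻¹' T.base x₀
    · have h1 : T.triv y (c t) v ∈ LinearMap.range (T.triv x₀ (c t)) := by
        rw [T.range_triv x₀ _ ht.2, ← T.range_triv y _ (hm ht.1)]
        exact LinearMap.mem_range_self _ _
      obtain ⟨w, hw⟩ := h1
      exact ⟨w, fun _ => hw.symm⟩
    · exact ⟨0, fun h => absurd h ht⟩
  choose w hw using hex
  exact ⟨w, T.smooth_transition y x₀ _ c (fun _ => v) w (hc.isOpen_inter hJ (T.isOpen_base x₀))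
    (hc.mono inter_subset_left) (fun t ht => ⟨hm ht.1, ht.2⟩) (curveSmoothOn_const _ _) hw, hw⟩

theorem Admissible.congr [ConvenientSpace E] {U : Set M} (hU : IsOpen U) {f g : M → ℝ}
    (hf : T.Admissible U f) (h : ∀ x ∈ U, g x = f x) : T.Admissible U g := by
  obtain ⟨hs, α, hα, hαf⟩ := hf
  refine ⟨fun J c hJ hc hm => (hs J c hJ hc hm).congr hJ fun t ht => h _ (hm ht), α, hα,
    fun x hx v => ?_⟩
  rw [hαf x hx, dFun_congr hU h hx]

end WeakSubbundle

namespace AlmostAnchor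

variable {T : WeakSubbundle E M F}

theorem bracket_eq (P : AlmostAnchor T) (f : M → ℝ) {g : M → ℝ} {x : M} (η : T.fiber x)
    (hη : ∀ v : TSpace E x, η.1 v = dFun g x v) : P.bracket f g x = -dFun f x (P.toFun x η) := by
  have h : ∃ η : T.fiber x, ∀ v : TSpace E x, η.1 v = dFun g x v := ⟨η, hη⟩
  have h1 : h.choose = η := Subtype.ext (cotSpace_ext fun v => by rw [h.choose_spec, hη])
  rw [bracket, dif_pos h, h1]

theorem bracket_congr [ConvenientSpace E] (P : AlmostAnchor T) {U : Set M} (hU : IsOpen U)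
    {f f' g g' : M → ℝ} (hf : ∀ x ∈ U, f x = f' x) (hg : ∀ x ∈ U, g x = g' x) {x : M}
    (hx : x ∈ U) : P.bracket f g x = P.bracket f' g' x := by
  have h1 : dFun (E := E) f x = dFun f' x := funext fun v => dFun_congr hU hf hx v
  have h2 : dFun (E := E) g x = dFun g' x := funext fun v => dFun_congr hU hg hx v
  unfold bracket
  rw [h1, h2]

theorem toFun_injective : Function.Injective (AlmostAnchor.toFun (T := T)) := by
  rintro ⟨p, _, _⟩ ⟨q, _, _⟩ h
  cases h
  rfl

end AlmostAnchor

end Subbundle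

/-! ### Projecting the anchor and its bracket to the quotient. -/

section Reduction

universe u v

variable {E : Type u} [AddCommGroup E] [Module ℝ E] [TopologicalSpace E] [ConvenientSpace E]
  {M : Type v} [TopologicalSpace M] [ChartedSpace (CInf E) M] [ConvenientManifold E M]
  {F : Type*} [AddCommGroup F] [Module ℝ F] [TopologicalSpace F]
  {E' : Type*} [AddCommGroup E'] [Module ℝ E'] [TopologicalSpace E'] [ConvenientSpace E']
  {M' : Type*} [TopologicalSpace M'] [ChartedSpace (CInf E') M'] [ConvenientManifold E' M']
  {F' : Type*} [AddCommGroup F'] [Module ℝ F'] [TopologicalSpace F']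
  {T : WeakSubbundle E M F} {P : AlmostAnchor T} {D : ∀ x : M, Submodule ℝ (TSpace E x)}
  {j : M → M'} {T' : WeakSubbundle E' M' F'}

-- A local section through the covector, restricted to a constant curve, brings condition (a) down
-- to a single point.
omit [ConvenientSpace E] [ConvenientSpace E'] [ConvenientManifold E M]
  [ConvenientManifold E' M'] in
theorem IsInduced.exists_pullback (hT' : IsInduced T T' j) {x : M} {ξ' : CotSpace E' (j x)}
    (hξ' : ξ' ∈ T'.fiber (j x)) : ∃ ξ : T.fiber x, IsPullback j x ξ' ξ.1 := by
  obtain ⟨V, α, hV, hyV, hα, -, hαy⟩ := T'.exists_section hξ'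
  obtain ⟨ξ, hξ, hpull⟩ := hT'.pullback_smooth univ (fun _ => x) (fun _ => α (j x)) isOpen_univ
    (mCurveSmoothOn_const _ _) (hα univ (fun _ => j x) isOpen_univ (mCurveSmoothOn_const _ _)
      fun _ _ => hyV)
  refine ⟨⟨ξ 0, hξ.mem_fiber (mem_univ 0)⟩, ?_⟩
  rw [← hαy]
  exact hpull 0 (mem_univ 0)

omit [ConvenientSpace E] [ConvenientSpace E'] [ConvenientManifold E M]
  [ConvenientManifold E' M'] in
/-- The pullback of a section of the induced subbundle. -/
theorem IsInduced.exists_pullback_section (hT' : IsInduced T T' j) (hj : SmoothMap E E' j)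
    {V : Set M'} {α' : ∀ y : M', CotSpace E' y} (hα' : T'.SectionOn V α') :
    ∃ α : ∀ x : M, T.fiber x, T.SectionOn (j ⁻¹' V) (fun x => (α x).1) ∧
      ∀ x ∈ j ⁻¹' V, IsPullback j x (α' (j x)) (α x).1 := by
  have hex : ∀ x : M, ∃ ξ : T.fiber x, x ∈ j ⁻¹' V → IsPullback j x (α' (j x)) ξ.1 := fun x => by
    by_cases hx : x ∈ j ⁻¹' V
    · obtain ⟨ξ, hξ⟩ := hT'.exists_pullback (x := x) (hα'.mem_fiber hx)
      exact ⟨ξ, fun _ => hξ⟩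
    · exact ⟨0, fun h => absurd h hx⟩
  choose α hα using hex
  refine ⟨α, fun J c hJ hc hm => ?_, hα⟩
  obtain ⟨ξ, hξ, hpull⟩ := hT'.pullback_smooth J c (fun t => α' (j (c t))) hJ hc
    (hα' J (j ∘ c) hJ (hj J c hJ hc) hm)
  refine hξ.congr hJ (fun _ _ => rfl) fun t ht v => ?_
  exact (hα (c t) (hm ht) v).trans (hpull t ht v).symm

omit [ConvenientSpace E] [ConvenientSpace E'] [ConvenientManifold E M]
  [ConvenientManifold E' M'] in
/-- The value of the projected anchor does not depend on the point in the leaf. -/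
theorem MapsProjectable.dMap_eq (hPpP : MapsProjectable (E' := E') P D j)
    (hj : IsLeafQuotient E E' D j) (hT' : IsInduced T T' j) {x₁ x₂ : M} (hx : j x₂ = j x₁)
    {ξ' : CotSpace E' (j x₁)} (hξ' : ξ' ∈ T'.fiber (j x₁)) {ξ₁ : T.fiber x₁} {ξ₂ : T.fiber x₂}
    (h₁ : ∀ v : E, ξ₁.1 v = ξ' (dMap j x₁ v)) (h₂ : ∀ v : E, ξ₂.1 v = ξ' (dMap j x₂ v)) :
    (dMap j x₂ (P.toFun x₂ ξ₂) : E') = dMap j x₁ (P.toFun x₁ ξ₁) := by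
  obtain ⟨V, α', hV, hyV, hα', hform, hαy⟩ := T'.exists_section hξ'
  obtain ⟨α, hα, hpull⟩ := hT'.exists_pullback_section hj.submersion.1 hα'
  have hx₂V : x₂ ∈ j ⁻¹' V := by rwa [mem_preimage, hx]
  -- The given covector has been extended to a local section so that (PpP), a condition on forms,
  -- applies to the leaf through both points.
  have key := hPpP V hV α hα ⟨α', hform, hpull⟩ (j ⁻¹' {j x₁}) (hj.fiber_leaf _) x₂ ⟨hx, hx₂V⟩ x₁
    ⟨rfl, hyV⟩
  have e₁ : α x₁ = ξ₁ := Subtype.ext (cotSpace_ext fun v => by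
    rw [hpull x₁ hyV v, hαy, h₁])
  have e₂ : α x₂ = ξ₂ := Subtype.ext (cotSpace_ext fun v => by
    rw [hpull x₂ hx₂V v, h₂, ← hαy]
    exact cotSpace_congr α' hx _)
  simp only [e₁, e₂] at key
  exact key

/-- The projected anchor, as a family of linear maps. -/
theorem MapsProjectable.exists_linearMap (hPpP : MapsProjectable (E' := E') P D j)
    (hj : IsLeafQuotient E E' D j) (hT' : IsInduced T T' j) (y : M') :
    ∃ L : T'.fiber y →ₗ[ℝ] TSpace E' y, ∀ (x : M) (ξ : T.fiber x) (ξ' : T'.fiber y), j x = y →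
      (∀ v : E, ξ.1 v = ξ'.1 (dMap (E' := E') j x v)) →
      L ξ' = (dMap (E' := E') j x (P.toFun x ξ) : E') := by
  obtain ⟨x₀, rfl⟩ := hj.surjective y
  choose p hp using fun ξ' : T'.fiber (j x₀) => hT'.exists_pullback (x := x₀) ξ'.2
  obtain ⟨L, hL⟩ := hj.submersion.1.exists_linearMap_eq_dMap x₀
  have hpu : ∀ (ξ' : T'.fiber (j x₀)) (ξ : T.fiber x₀),
      (∀ v : E, ξ.1 v = ξ'.1 (dMap j x₀ v)) → p ξ' = ξ := fun ξ' ξ h =>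
    Subtype.ext (cotSpace_ext fun v => by rw [hp ξ' v, h])
  -- The chosen pullback is linear because a pullback is determined by its values.
  refine ⟨L ∘ₗ P.toFun x₀ ∘ₗ { toFun := p, map_add' := fun ξ η => ?_, map_smul' := fun a ξ => ?_ },
    fun x ξ ξ' hx h => ?_⟩
  · refine hpu _ _ fun v => ?_
    change (p ξ).1 v + (p η).1 v = ξ.1 (dMap j x₀ v) + η.1 (dMap j x₀ v)
    rw [hp ξ v, hp η v]
  · refine hpu _ _ fun v => ?_
    change a * (p ξ).1 v = a * ξ.1 (dMap j x₀ v)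
    rw [hp ξ v]
  · refine (hL _).trans ?_
    exact (hPpP.dMap_eq hj hT' hx ξ'.2 (hp ξ') h).symm

/-- The projected anchor. -/
theorem MapsProjectable.exists_anchor (hPpP : MapsProjectable (E' := E') P D j)
    (hj : IsLeafQuotient E E' D j) (hT' : IsInduced T T' j) :
    ∃ P' : AlmostAnchor T', ∀ (x : M) (ξ : T.fiber x) (ξ' : T'.fiber (j x)),
      IsPullback j x ξ'.1 ξ.1 → P'.toFun (j x) ξ' = dMap j x (P.toFun x ξ) := by
  classical
  choose L hL using hPpP.exists_linearMap hj hT'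
  refine ⟨⟨L, fun J c' ξ' hJ h => ⟨h.1, fun ψ hψ => .of_locally fun t₀ ht₀ => ?_⟩,
    fun y ξ' η' => ?_⟩, fun x ξ ξ' h => hL (j x) x ξ ξ' rfl h⟩
  · obtain ⟨x₀, hx₀⟩ := hj.surjective (c' t₀)
    obtain ⟨J₀, c, hJ₀, ht₀J, hJJ, hc, hjc⟩ := hj.submersion.exists_lift hJ h.1 ht₀.1 hx₀
    obtain ⟨ξ, hξ, hpull⟩ := hT'.pullback_smooth J₀ c (fun t => (ξ' t).1) hJ₀ hc
      ((h.mono hJJ).congr hJ₀ hjc fun _ _ _ => rfl)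
    -- Smoothness of `P` is stated for fibre-valued families defined for all `t`; the value `0` off
    -- `J₀` plays no role.
    set ζ : ∀ t, T.fiber (c t) := fun t =>
      if ht : ξ t ∈ T.fiber (c t) then ⟨ξ t, ht⟩ else 0 with hζ
    have hζξ : ∀ t ∈ J₀, (ζ t).1 = ξ t := fun t ht => by
      simp only [hζ, dif_pos (hξ.mem_fiber ht)]
    have hζs : T.CurveSmoothOn J₀ c (fun t => (ζ t).1) :=
      hξ.congr hJ₀ (fun _ _ => rfl) fun t ht v => by rw [hζξ t ht]
    have hw := hj.submersion.1.tangentCurveSmoothOn hJ₀ (P.smooth J₀ c ζ hJ₀ hζs)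
    have ht₀' : t₀ ∈ J₀ ∩ (fun t => j (c t)) ⁻¹' ψ.source :=
      ⟨ht₀J, by rw [mem_preimage, hjc t₀ ht₀J]; exact ht₀.2⟩
    refine ⟨_, _, ht₀', hw.2 ψ hψ, eventually_of_mem (hJ₀.mem_nhds ht₀J) fun t ht => ?_⟩
    refine tangentCoord_congr ψ (hjc t ht).symm (hL (c' t) (c t) (ζ t) (ξ' t) (hjc t ht) ?_)
    intro v
    rw [hζξ t ht]
    exact hpull t ht v
  · obtain ⟨x, rfl⟩ := hj.surjective y
    obtain ⟨ξ, hξ⟩ := hT'.exists_pullback (x := x) ξ'.2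
    obtain ⟨η, hη⟩ := hT'.exists_pullback (x := x) η'.2
    rw [hL _ x ξ ξ' rfl hξ, hL _ x η η' rfl hη]
    -- Pairing `ξ'` with a pushed-down vector equals pairing its pullback with the vector upstairs.
    exact (hξ _).symm.trans ((P.antisymm x ξ η).trans (congrArg Neg.neg (hη _)))

/-- Admissible functions pull back to admissible functions. -/
theorem IsInduced.admissible_comp (hT' : IsInduced T T' j) (hj : SmoothMap E E' j) {V : Set M'}
    (hV : IsOpen V) {f : M' → ℝ} (hf : T'.Admissible V f) : T.Admissible (j ⁻¹' V) (f ∘ j) := by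
  obtain ⟨hs, α', hα', hαf⟩ := hf
  obtain ⟨α, hα, hpull⟩ := hT'.exists_pullback_section hj hα'
  refine ⟨hj.smoothFunOn_comp hs, fun x => (α x).1, hα, fun x hx v => ?_⟩
  rw [hpull x hx v, hαf _ hx, hj.dFun_comp hV hs hx]

/-- Functions with admissible pullback are admissible. -/
theorem IsInduced.admissible_of_comp (hT' : IsInduced T T' j) (hj : IsSubmersion E E' j)
    (hsurj : Function.Surjective j) {V : Set M'} (hV : IsOpen V) {f : M' → ℝ}
    (hf : T.Admissible (j ⁻¹' V) (f ∘ j)) : T'.Admissible V f := by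
  obtain ⟨hs, α, hα, hαf⟩ := hf
  have hs' : SmoothFunOn E' V f := fun J c' hJ hc' hm => .of_locally fun t₀ ht₀ => by
    obtain ⟨x₀, hx₀⟩ := hsurj (c' t₀)
    obtain ⟨J₀, c, hJ₀, ht₀J, hJJ, hc, hjc⟩ := hj.exists_lift hJ hc' ht₀ hx₀
    refine ⟨J₀, _, ht₀J, hs J₀ c hJ₀ hc fun t ht => ?_,
      eventually_of_mem (hJ₀.mem_nhds ht₀J) fun t ht => ?_⟩
    · rw [mem_preimage, hjc t ht]
      exact hm (hJJ ht)
    · simp only [Function.comp_apply, hjc t ht]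
  have hex : ∀ y : M', ∃ ξ : CotSpace E' y, y ∈ V → ∀ v : TSpace E' y, ξ v = dFun f y v :=
    fun y => by
      by_cases hy : y ∈ V
      · obtain ⟨ξ, hξ⟩ := hs'.exists_cotangent hV hy
        exact ⟨ξ, fun _ => hξ⟩
      · exact ⟨0, fun h => absurd h hy⟩
  choose α' hα' using hex
  -- Condition (b) applies since, by the chain rule, the differential of `f` pulls back to that of
  -- `f ∘ j`.
  refine ⟨hs', α', hT'.maximal V α' α hV hα fun x hx v => ?_, hα'⟩
  rw [hαf x hx, hα' _ hx, hj.1.dFun_comp hV hs' hx]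

/-- Brackets of pulled back functions. -/
theorem IsInduced.bracket_comp (hT' : IsInduced T T' j) (hj : SmoothMap E E' j)
    {P' : AlmostAnchor T'} (hP' : ∀ (x : M) (ξ : T.fiber x) (ξ' : T'.fiber (j x)),
      IsPullback j x ξ'.1 ξ.1 → P'.toFun (j x) ξ' = dMap j x (P.toFun x ξ))
    {V : Set M'} (hV : IsOpen V) {f g : M' → ℝ} (hf : T'.Admissible V f)
    (hg : T'.Admissible V g) {x : M} (hx : x ∈ j ⁻¹' V) :
    P'.bracket f g (j x) = P.bracket (f ∘ j) (g ∘ j) x := by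
  obtain ⟨hgs, α', hα', hαg⟩ := hg
  have hmem := hα'.mem_fiber hx
  obtain ⟨η, hη⟩ := hT'.exists_pullback hmem
  rw [P'.bracket_eq f ⟨α' (j x), hmem⟩ (hαg _ hx), P.bracket_eq (f ∘ j) η fun v => by
    rw [hη v, hαg _ hx, hj.dFun_comp hV hgs hx], hj.dFun_comp hV hf.1 hx, hP' x η _ hη]

/-- The projected anchor defines a partial Poisson structure. -/
theorem IsInduced.isPartialPoisson (hT' : IsInduced T T' j) (hj : IsSubmersion E E' j)
    (hsurj : Function.Surjective j) (hP : P.IsPartialPoisson)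
    {P' : AlmostAnchor T'} (hP' : ∀ (x : M) (ξ : T.fiber x) (ξ' : T'.fiber (j x)),
      IsPullback j x ξ'.1 ξ.1 → P'.toFun (j x) ξ' = dMap j x (P.toFun x ξ)) :
    P'.IsPartialPoisson := by
  have hcomp : ∀ {V : Set M'} {f g : M' → ℝ}, IsOpen V → T'.Admissible V f →
      T'.Admissible V g → ∀ x ∈ j ⁻¹' V, (P'.bracket f g ∘ j) x = P.bracket (f ∘ j) (g ∘ j) x :=
    fun hV hf hg x hx => hT'.bracket_comp hj.1 hP' hV hf hg hx
  have hpre : ∀ {V : Set M'}, IsOpen V → IsOpen (j ⁻¹' V) := fun hV =>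
    hV.preimage hj.1.continuous
  have hmem : ∀ (V : Set M') (f g : M' → ℝ), IsOpen V → T'.Admissible V f → T'.Admissible V g →
      T'.Admissible V (P'.bracket f g) := fun V f g hV hf hg =>
    hT'.admissible_of_comp hj hsurj hV ((hP.bracket_mem _ _ _ (hpre hV)
      (hT'.admissible_comp hj.1 hV hf) (hT'.admissible_comp hj.1 hV hg)).congr (hpre hV)
        (hcomp hV hf hg))
  refine ⟨hmem, fun V f g h hV hf hg hh y hy => ?_⟩
  obtain ⟨x, rfl⟩ := hsurj y
  -- The inner brackets agree only on `j ⁻¹' V`; as the bracket is local and `j ⁻¹' V` is open, this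
  -- is enough for the outer one.
  have hdouble : ∀ {f g h : M' → ℝ}, T'.Admissible V f → T'.Admissible V g → T'.Admissible V h →
      P'.bracket f (P'.bracket g h) (j x) = P.bracket (f ∘ j) (P.bracket (g ∘ j) (h ∘ j)) x :=
    fun {f g h} hf hg hh => (hcomp hV hf (hmem V g h hV hg hh) x hy).trans
      (P.bracket_congr (hpre hV) (fun _ _ => rfl) (hcomp hV hg hh) hy)
  rw [hdouble hf hg hh, hdouble hg hh hf, hdouble hh hf hg]
  exact hP.jacobi (j ⁻¹' V) _ _ _ (hpre hV) (hT'.admissible_comp hj.1 hV hf)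
    (hT'.admissible_comp hj.1 hV hg) (hT'.admissible_comp hj.1 hV hh) x hy

end Reduction

end PartialPoisson

end

theorem mainTheorem7
    {E : Type*} [AddCommGroup E] [Module ℝ E] [TopologicalSpace E] [ConvenientSpace E]
    {M : Type*} [TopologicalSpace M] [ChartedSpace (CInf E) M] [ConvenientManifold E M]
    {F : Type*} [AddCommGroup F] [Module ℝ F] [TopologicalSpace F] [ConvenientSpace F]
    {E' : Type*} [AddCommGroup E'] [Module ℝ E'] [TopologicalSpace E'] [ConvenientSpace E']
    {M' : Type*} [TopologicalSpace M'] [ChartedSpace (CInf E') M'] [ConvenientManifold E' M']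
    {F' : Type*} [AddCommGroup F'] [Module ℝ F'] [TopologicalSpace F'] [ConvenientSpace F']
    (T : WeakSubbundle E M F) (P : AlmostAnchor T) (hP : P.IsPartialPoisson)
    (D : ∀ x : M, Submodule ℝ (TSpace E x)) (hD : IsIntegrable D)
    (j : M → M') (hj : IsLeafQuotient E E' D j)
    (T' : WeakSubbundle E' M' F') (hT' : IsInduced T T' j)
    (hPpP : MapsProjectable (E' := E') P D j) :
    ∃! P' : AlmostAnchor T', IsProjectedAnchor P P' j ∧ P'.IsPartialPoisson := by
  obtain ⟨P', hP'⟩ := hPpP.exists_anchor hj hT'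
  refine ⟨P', ⟨fun x ξ' => ?_, hT'.isPartialPoisson hj.submersion hj.surjective hP hP'⟩,
    fun Q hQ => AlmostAnchor.toFun_injective (funext fun y => LinearMap.ext fun ξ' => ?_)⟩
  · obtain ⟨ξ, hξ⟩ := hT'.exists_pullback ξ'.2
    exact ⟨ξ, hξ, hP' x ξ ξ' hξ⟩
  · obtain ⟨x, rfl⟩ := hj.surjective y
    obtain ⟨ξ, hξ, hQξ⟩ := hQ.1 x ξ'
    rw [hQξ, hP' x ξ ξ' hξ]
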